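/- Let $0<y<1$ and let $u:[0,\infty)\to(0,\infty)$ be twice differentiable, such that $\psi(t)=t\,u(t)$ is strictly increasing, $\lim_{t\to\infty}\psi(t)>y$ (the limit may be $+\infty$), and $t\,u'(t)<u(t)$ for all $t\ge 0$. For points $x_1,\dots,x_n\in\mathbb R^p$, Maronna's M-estimator $\bar\Sigma$ is the positive definite $p\times p$ matrix with $\bar\Sigma=\sum_{i=1}^n u(x_i^T\bar\Sigma^{-1}x_i)\,x_ix_i^T$. Let $\psi^{-1}(y)$ be the unique $t\geq 0$ with $\psi(t)=y$, and $\|\cdot\|$ the Euclidean operator norm. Then there exist $C,c,c'>0$, depending only on $y$ and $u$, such that for every $0<\varepsilon<c'$ there is $\delta>0$ with the following property. For all integers $n\ge1$ and $p$ with $|p/n-y|<\delta$ (thus for all $n$ if $p/n=y$, and for all sufficiently large $n$ if $p=p_n$ with $p_n/n\to y$), every positive definite $T_p\in\mathbb R^{p\times p}$, and i.i.d. samples $x_1,\dots,x_n$ from $N(0,T_p)$, with probability at least $1-Cne^{-c\varepsilon^2n}$ Maronna's M-estimator $\bar\Sigma$ exists, is unique, and satisfies $$\Big\|T_p^{-1/2}\Big(\frac{1}{n\,u(\psi^{-1}(y))}\,\bar\Sigma-\frac1n\sum_{i=1}^n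 x_ix_i^T\Big)T_p^{-1/2}\Big\|\le\varepsilon .$$ -/

import Mathlib

open MeasureTheory ProbabilityTheory Filter Topology
open scoped MatrixOrder

namespace Maronna

/-- `ψ(t) = t u(t)`. -/
def psi (u : ℝ → ℝ) (t : ℝ) : ℝ := t * u t

/-- The assumptions on the weight function `u : [0, ∞) → (0, ∞)` (only the values on `[0, ∞)`
matter; derivatives at `0` are one-sided). -/
structure WeightAssumptions (u : ℝ → ℝ) (y : ℝ) : Prop where
  pos : ∀ t, 0 ≤ t → 0 < u t
  psi_strictMono : StrictMonoOn (psi u) (Set.Ici 0)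
  psi_lim : ∃ L : EReal, Tendsto (fun t : ℝ => (psi u t : EReal)) atTop (𝓝 L) ∧ (y : EReal) < L
  differentiable : DifferentiableOn ℝ u (Set.Ici 0)
  differentiable_deriv : DifferentiableOn ℝ (derivWithin u (Set.Ici 0)) (Set.Ici 0)
  mul_deriv_lt : ∀ t, 0 ≤ t → t * derivWithin u (Set.Ici 0) t < u t

/-- The inverse `ψ⁻¹` of `ψ : [0, ∞) → [0, ∞)`. -/
noncomputable def psiInv (u : ℝ → ℝ) (y : ℝ) : ℝ :=
  Function.invFunOn (psi u) (Set.Ici 0) y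

/-- The value `ψ⁻¹(y)` is the unique `t ≥ 0` with `t u(t) = y`. -/
theorem psiInv_spec {u : ℝ → ℝ} {y : ℝ} (hy : 0 < y) (hu : WeightAssumptions u y) :
    0 ≤ psiInv u y ∧ psi u (psiInv u y) = y ∧
      ∀ t, 0 ≤ t → psi u t = y → t = psiInv u y := by
  have hc : ContinuousOn (psi u) (Set.Ici 0) :=
    continuousOn_id.mul hu.differentiable.continuousOn
  obtain ⟨L, hL, hyL⟩ := hu.psi_lim
  obtain ⟨b, hb, hb0⟩ := ((hL.eventually (lt_mem_nhds hyL)).and (eventually_ge_atTop 0)).exists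
  have hb' : y < psi u b := by exact_mod_cast hb
  have hmem : ∃ t ∈ Set.Ici (0 : ℝ), psi u t = y := by
    have h := intermediate_value_Icc hb0 (hc.mono Set.Icc_subset_Ici_self)
    have h0 : psi u 0 = 0 := by simp [psi]
    obtain ⟨t, ht, hty⟩ := h ⟨by rw [h0]; exact hy.le, hb'.le⟩
    exact ⟨t, ht.1, hty⟩
  have h1 : 0 ≤ psiInv u y := Function.invFunOn_mem hmem
  have h2 : psi u (psiInv u y) = y := Function.invFunOn_eq hmem
  exact ⟨h1, h2, fun t ht hty => hu.psi_strictMono.injOn ht h1 (hty.trans h2.symm)⟩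

/-- `x xᵀ`. -/
def outer {p : ℕ} (x : EuclideanSpace ℝ (Fin p)) : Matrix (Fin p) (Fin p) ℝ :=
  Matrix.vecMulVec x.ofLp x.ofLp

/-- The quadratic form `xᵀ M x`. -/
def quad {p : ℕ} (M : Matrix (Fin p) (Fin p) ℝ) (x : EuclideanSpace ℝ (Fin p)) : ℝ :=
  x.ofLp ⬝ᵥ (M.mulVec x.ofLp)

/-- `Σ` is a Maronna M-estimator of scatter of the sample `x₁, …, xₙ` for the weight function `u`:
a positive definite solution of `Σ = ∑ᵢ u(xᵢᵀ Σ⁻¹ xᵢ) xᵢ xᵢᵀ`. -/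
def IsMEstimator {n p : ℕ} (u : ℝ → ℝ) (x : Fin n → EuclideanSpace ℝ (Fin p))
    (S : Matrix (Fin p) (Fin p) ℝ) : Prop :=
  S.PosDef ∧ S = ∑ i, u (quad S⁻¹ (x i)) • outer (x i)

/-- The sample covariance matrix `(1/n) ∑ᵢ xᵢ xᵢᵀ`. -/
noncomputable def sampleCov {n p : ℕ} (x : Fin n → EuclideanSpace ℝ (Fin p)) :
    Matrix (Fin p) (Fin p) ℝ :=
  (1 / (n : ℝ)) • ∑ i, outer (x i)

/-- The operator norm of a square matrix for the Euclidean norm. -/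
noncomputable def opNorm {p : ℕ} (M : Matrix (Fin p) (Fin p) ℝ) : ℝ :=
  ‖Matrix.toEuclideanCLM (n := Fin p) (𝕜 := ℝ) M‖

/-- `T^{-1/2} M T^{-1/2}` for a positive definite matrix `T`, with `T^{1/2}` the positive definite
square root. -/
noncomputable def whiten {p : ℕ} (T M : Matrix (Fin p) (Fin p) ℝ) : Matrix (Fin p) (Fin p) ℝ :=
  (CFC.sqrt T)⁻¹ * M * (CFC.sqrt T)⁻¹

/-- For the sample `x`, the M-estimator `Σ̄` exists and is unique, and
`‖T^{-1/2} (Σ̄ / (n u(ψ⁻¹(y))) - (1/n) ∑ᵢ xᵢ xᵢᵀ) T^{-1/2}‖ ≤ ε`. -/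
def GoodSample {n p : ℕ} (u : ℝ → ℝ) (y : ℝ) (T : Matrix (Fin p) (Fin p) ℝ) (ε : ℝ)
    (x : Fin n → EuclideanSpace ℝ (Fin p)) : Prop :=
  (∃! S, IsMEstimator u x S) ∧
    ∀ S, IsMEstimator u x S →
      opNorm (whiten T ((1 / (n * u (psiInv u y))) • S - sampleCov x)) ≤ ε

end Maronna

/-!
For weights `w`, put `Σ = ∑ᵢ wᵢ xᵢ xᵢᵀ` and `ℓᵢ(w) = xᵢᵀ Σ⁻¹ xᵢ`, so that the M-estimators
correspond to the solutions of `w = u(ℓ(w))`. In logarithmic coordinates `w ↦ ℓ(w)` is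
nonexpansive for the sup norm, being antitone and homogeneous of degree `-1`, while the
hypotheses on `u` make `u` strictly nonexpansive. Hence there is at most one solution, and
Edelstein's fixed point theorem provides one as soon as some closed ball is mapped to itself.

The unweighted leverages `ℓᵢ(1)` are the diagonal entries of the hat matrix, which for a
Gaussian sample is a uniformly random orthogonal projection of rank `p`. With the stated
probability they lie within `ε` of `y`, and most entries of every row of the hat matrix have the
order of magnitude `n^{-1/2}`. The latter improves the nonexpansiveness of `ℓ`: if the ratio
`max w / min w` is not close to `1`, the oscillation of `log ℓ(w)` is smaller than that of `log
w` by a definite amount, up to the oscillation `O(ε)` of `log ℓ(1)`. Since `u` does not increase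
oscillation, at a solution all the `ℓᵢ` agree up to a factor `1 + O(ε)`. Their common value is
read off from `∑ᵢ wᵢ ℓᵢ(w) = tr(Σ⁻¹ Σ) = p`, that is, `ψ(ℓᵢ)` has mean `p / n`: it is `ψ⁻¹(y)`.
Hence `wᵢ = u(ψ⁻¹(y)) (1 + O(ε))`, and it remains to use `‖∑ᵢ xᵢ xᵢᵀ‖ = O(n)`. A general `T`
reduces to the identity by affine equivariance.
-/

namespace Maronna

section FixedPoint

theorem continuous_of_dist_lt {X Y : Type*} [PseudoMetricSpace X] [PseudoMetricSpace Y] {f : X → Y}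
    (hf : ∀ x z, x ≠ z → dist (f x) (f z) < dist x z) : Continuous f := by
  refine (LipschitzWith.of_dist_le_mul (K := 1) fun x z => ?_).continuous
  rcases eq_or_ne x z with rfl | h
  · simp
  · simpa using (hf x z h).le

-- Edelstein: `x ↦ dist x (f x)` attains its minimum on `K`, and `f` would decrease a positive one.
theorem exists_isFixedPt_of_dist_lt {X : Type*} [MetricSpace X] {K : Set X} (hK : IsCompact K)
    (hne : K.Nonempty) {f : X → X} (hmaps : Set.MapsTo f K K)
    (hf : ∀ x z, x ≠ z → dist (f x) (f z) < dist x z) : ∃ x ∈ K, Function.IsFixedPt f x := by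
  have hcont := continuous_of_dist_lt hf
  obtain ⟨x, hxK, hx⟩ := hK.exists_isMinOn hne (f := fun x => dist x (f x)) (by fun_prop)
  refine ⟨x, hxK, ?_⟩
  by_contra hne
  exact (hf x (f x) (Ne.symm hne)).not_ge (hx (hmaps hxK))

theorem exists_mapsTo_closedBall_add {E Y : Type*} [NormedAddCommGroup E] [NormedSpace ℝ E]
    [ProperSpace E] [PseudoMetricSpace Y] {f : E → Y}
    (hf : ∀ x z, x ≠ z → dist (f x) (f z) < dist x z) (c : E) {r : ℝ} (hr : 0 < r) :
    ∃ η, 0 < η ∧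
      Set.MapsTo f (Metric.closedBall c (r + η)) (Metric.closedBall (f c) r) := by
  have hball : Metric.closedBall c r ⊆ f ⁻¹' Metric.ball (f c) r := fun x hx => by
    rcases eq_or_ne x c with rfl | hxc
    · simpa using hr
    · exact (hf x c hxc).trans_le hx
  obtain ⟨η, hη, hsub⟩ := (isCompact_closedBall c r).exists_cthickening_subset_open
    (Metric.isOpen_ball.preimage (continuous_of_dist_lt hf)) hball
  rw [cthickening_closedBall hη.le hr.le, add_comm] at hsub
  exact ⟨η, hη, fun x hx => Metric.ball_subset_closedBall (hsub hx)⟩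

end FixedPoint

section Log

variable {a b m : ℝ}

theorem log_sub_log_le (ha : 0 < a) (hb : 0 < b) : Real.log b - Real.log a ≤ (b - a) / a := by
  rw [← Real.log_div hb.ne' ha.ne', sub_div, div_self ha.ne']
  exact Real.log_le_sub_one_of_pos (div_pos hb ha)

theorem abs_log_sub_log_le_div (hm : 0 < m) (ha : m ≤ a) (hb : m ≤ b) :
    |Real.log b - Real.log a| ≤ |b - a| / m := by
  have key : ∀ {a b}, m ≤ a → m ≤ b → Real.log b - Real.log a ≤ |b - a| / m := fun ha hb =>
    (log_sub_log_le (hm.trans_le ha) (hm.trans_le hb)).trans <|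
      div_le_div₀ (abs_nonneg _) (le_abs_self _) hm ha
  rw [abs_le]
  have := key ha hb
  have := key hb ha
  rw [abs_sub_comm] at this
  constructor <;> linarith

end Log

section Weight

/-- The hypotheses on a weight function which the existence, uniqueness and consistency of
Maronna's M-estimator rest on: for two points `0 < s < t`, the ratio `u t / u s` lies strictly
between `s / t` and `t / s`, that is, `log u` is strictly nonexpansive as a function of `log t`. -/
structure AdmissibleWeight (u : ℝ → ℝ) : Prop where
  psi_strictMonoOn : StrictMonoOn (psi u) (Set.Ici 0)
  div_strictAntiOn : StrictAntiOn (fun t => u t / t) (Set.Ioi 0)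

theorem WeightAssumptions.admissibleWeight {u : ℝ → ℝ} {y : ℝ} (hu : WeightAssumptions u y) :
    AdmissibleWeight u := by
  refine ⟨hu.psi_strictMono, strictAntiOn_of_hasDerivWithinAt_neg (convex_Ioi 0)
    (f' := fun t => (derivWithin u (Set.Ici 0) t * t - u t * 1) / t ^ 2) ?_ ?_ ?_⟩
  · exact (hu.differentiable.continuousOn.mono Set.Ioi_subset_Ici_self).div continuousOn_id
      fun t ht => (Set.mem_Ioi.mp ht).ne'
  · rw [interior_Ioi]
    intro t ht
    exact ((hu.differentiable t (Set.Ioi_subset_Ici_self ht)).hasDerivWithinAt.mono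
      Set.Ioi_subset_Ici_self).div (hasDerivWithinAt_id t _) (Set.mem_Ioi.mp ht).ne'
  · rw [interior_Ioi]
    intro t ht
    have ht' : 0 < t := ht
    have := hu.mul_deriv_lt t ht'.le
    exact div_neg_of_neg_of_pos (by linarith) (by positivity)

/-- The weight function in logarithmic coordinates, where it is strictly nonexpansive. -/
noncomputable def logWeight (u : ℝ → ℝ) (s : ℝ) : ℝ := Real.log (u (Real.exp s))

theorem logWeight_log (u : ℝ → ℝ) {t : ℝ} (ht : 0 < t) :
    logWeight u (Real.log t) = Real.log (u t) := by
  rw [logWeight, Real.exp_log ht]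

namespace AdmissibleWeight

variable {u : ℝ → ℝ} (hu : AdmissibleWeight u)

include hu

theorem pos {t : ℝ} (ht : 0 < t) : 0 < u t := by
  have h := hu.psi_strictMonoOn Set.self_mem_Ici ht.le ht
  rw [psi, psi, zero_mul] at h
  exact pos_of_mul_pos_right h ht.le

theorem dist_logWeight_lt (s s' : ℝ) (hs : s ≠ s') :
    dist (logWeight u s) (logWeight u s') < dist s s' := by
  wlog h : s' < s generalizing s s'
  · rw [dist_comm, dist_comm s]
    exact this s' s hs.symm (hs.lt_of_le (not_lt.mp h))
  have hs₀ := Real.exp_pos s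
  have hs₀' := Real.exp_pos s'
  have hpos := hu.pos hs₀
  have hpos' := hu.pos hs₀'
  have hexp := Real.exp_lt_exp.mpr h
  have hpsi := Real.log_lt_log (mul_pos hs₀' hpos') (hu.psi_strictMonoOn hs₀'.le hs₀.le hexp)
  have hdiv := Real.log_lt_log (div_pos hpos hs₀) (hu.div_strictAntiOn hs₀' hs₀ hexp)
  rw [psi, Real.log_mul hs₀'.ne' hpos'.ne', Real.log_mul hs₀.ne' hpos.ne', Real.log_exp,
    Real.log_exp] at hpsi
  rw [Real.log_div hpos.ne' hs₀.ne', Real.log_div hpos'.ne' hs₀'.ne', Real.log_exp,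
    Real.log_exp] at hdiv
  rw [Real.dist_eq, Real.dist_eq, abs_of_pos (sub_pos.mpr h), abs_lt, logWeight, logWeight]
  constructor <;> linarith

theorem abs_log_sub_log_le {s t : ℝ} (hs : 0 < s) (ht : 0 < t) :
    |Real.log (u s) - Real.log (u t)| ≤ |Real.log s - Real.log t| := by
  rw [← logWeight_log u hs, ← logWeight_log u ht]
  rcases eq_or_ne (Real.log s) (Real.log t) with h | h
  · simp [h]
  · exact (hu.dist_logWeight_lt _ _ h).le

end AdmissibleWeight

variable {u : ℝ → ℝ} {y : ℝ} (hy : y ∈ psi u '' Set.Ici 0)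

include hy

theorem psi_psiInv : psi u (psiInv u y) = y := Function.invFunOn_eq hy

theorem psiInv_pos (hy₀ : 0 < y) : 0 < psiInv u y := by
  refine (Set.mem_Ici.mp (Function.invFunOn_mem hy)).lt_of_ne fun h => hy₀.ne ?_
  rw [← psi_psiInv hy, psiInv, ← h, psi, zero_mul]

theorem AdmissibleWeight.exists_log_psiInv_bounds (hu : AdmissibleWeight u) (hy₀ : 0 < y)
    {ε : ℝ} (hε : 0 < ε) :
    ∃ δ, 0 < δ ∧ ∀ t, 0 < t →
      (psi u t < y + δ → Real.log t < Real.log (psiInv u y) + ε) ∧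
      (y - δ < psi u t → Real.log (psiInv u y) - ε < Real.log t) := by
  have ht₀ := psiInv_pos hy hy₀
  have hup : 0 < psiInv u y * Real.exp ε := by positivity
  have hlow : 0 < psiInv u y * Real.exp (-ε) := by positivity
  have hψup : y < psi u (psiInv u y * Real.exp ε) := by
    conv_lhs => rw [← psi_psiInv hy]
    exact hu.psi_strictMonoOn ht₀.le hup.le
      (lt_mul_of_one_lt_right ht₀ (Real.one_lt_exp_iff.mpr hε))
  have hψlow : psi u (psiInv u y * Real.exp (-ε)) < y := by
    conv_rhs => rw [← psi_psiInv hy]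
    exact hu.psi_strictMonoOn hlow.le ht₀.le
      (mul_lt_of_lt_one_right ht₀ (Real.exp_lt_one_iff.mpr (neg_lt_zero.mpr hε)))
  obtain ⟨δ, hδ, hδ'⟩ := exists_between (lt_min (sub_pos.mpr hψup) (sub_pos.mpr hψlow))
  rw [lt_min_iff, lt_sub_iff_add_lt', lt_sub_comm] at hδ'
  refine ⟨δ, hδ, fun t ht => ⟨fun h => ?_, fun h => ?_⟩⟩
  · have := Real.log_lt_log ht
      ((hu.psi_strictMonoOn.lt_iff_lt ht.le hup.le).mp (h.trans hδ'.1))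
    rwa [Real.log_mul ht₀.ne' (Real.exp_pos _).ne', Real.log_exp] at this
  · have := Real.log_lt_log hlow
      ((hu.psi_strictMonoOn.lt_iff_lt hlow.le ht.le).mp (hδ'.2.trans h))
    rwa [Real.log_mul ht₀.ne' (Real.exp_pos _).ne', Real.log_exp] at this

end Weight

theorem le_of_sq_le_mul {a b : ℝ} (h : a ^ 2 ≤ a * b) (hb : 0 ≤ b) : a ≤ b := by
  by_contra! hba
  nlinarith

section Scatter

variable {n p : ℕ}

theorem quad_nonneg {M : Matrix (Fin p) (Fin p) ℝ} (hM : M.PosSemidef)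
    (z : EuclideanSpace ℝ (Fin p)) : 0 ≤ quad M z := by
  simpa [quad] using hM.dotProduct_mulVec_nonneg z.ofLp

theorem quad_pos {M : Matrix (Fin p) (Fin p) ℝ} (hM : M.PosDef) {z : EuclideanSpace ℝ (Fin p)}
    (hz : z ≠ 0) : 0 < quad M z := by
  simpa [quad] using hM.dotProduct_mulVec_pos (x := z.ofLp) (by simpa using hz)

/-- The weighted scatter matrix `∑ᵢ wᵢ xᵢ xᵢᵀ` of the sample `x`. -/
noncomputable def scatter (x : Fin n → EuclideanSpace ℝ (Fin p)) (w : Fin n → ℝ) :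
    Matrix (Fin p) (Fin p) ℝ :=
  ∑ i, w i • outer (x i)

/-- The cross-leverage `xⱼᵀ S⁻¹ xᵢ` of two sample points, for the weighted scatter matrix `S`. With
unit weights it is the `(i, j)` entry of the hat matrix of the sample. -/
noncomputable def cross (x : Fin n → EuclideanSpace ℝ (Fin p)) (w : Fin n → ℝ) (i j : Fin n) : ℝ :=
  (x j).ofLp ⬝ᵥ (scatter x w)⁻¹.mulVec (x i).ofLp

/-- The leverage `xᵢᵀ S⁻¹ xᵢ` of a sample point, for the weighted scatter matrix `S`. -/
noncomputable def lev (x : Fin n → EuclideanSpace ℝ (Fin p)) (w : Fin n → ℝ) (i : Fin n) : ℝ :=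
  quad (scatter x w)⁻¹ (x i)

variable {x : Fin n → EuclideanSpace ℝ (Fin p)} {w w' : Fin n → ℝ} {i : Fin n}

theorem cross_self : cross x w i i = lev x w i := rfl

theorem dotProduct_outer_mulVec (z : EuclideanSpace ℝ (Fin p)) (a b : Fin p → ℝ) :
    a ⬝ᵥ (outer z).mulVec b = (z.ofLp ⬝ᵥ a) * (z.ofLp ⬝ᵥ b) := by
  rw [outer, Matrix.vecMulVec_mulVec, dotProduct_comm a, op_smul_eq_smul, smul_dotProduct,
    smul_eq_mul, mul_comm]

theorem dotProduct_scatter_mulVec (a b : Fin p → ℝ) :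
    a ⬝ᵥ (scatter x w).mulVec b = ∑ j, w j * (((x j).ofLp ⬝ᵥ a) * ((x j).ofLp ⬝ᵥ b)) := by
  simp_rw [scatter, Matrix.sum_mulVec, Matrix.smul_mulVec, dotProduct_sum, dotProduct_smul,
    dotProduct_outer_mulVec, smul_eq_mul]

theorem isHermitian_scatter : (scatter x w).IsHermitian := by
  ext a b
  simp [scatter, outer, Matrix.sum_apply, Matrix.vecMulVec_apply, mul_comm]

theorem posDef_scatter (hS : (scatter x 1).PosDef) (hw : ∀ i, 0 < w i) : (scatter x w).PosDef := by
  refine Matrix.PosDef.of_dotProduct_mulVec_pos isHermitian_scatter fun {v} hv => ?_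
  have h := hS.dotProduct_mulVec_pos hv
  rw [star_trivial, dotProduct_scatter_mulVec] at h ⊢
  obtain ⟨j, -, hj⟩ := Finset.exists_lt_of_sum_lt (s := Finset.univ)
    (f := fun _ : Fin n => (0 : ℝ)) (by simpa using h)
  exact Finset.sum_pos' (fun i _ => mul_nonneg (hw i).le (mul_self_nonneg _))
    ⟨j, Finset.mem_univ _, mul_pos (hw j) (by simpa using hj)⟩

theorem scatter_smul (k : ℝ) : scatter x (k • w) = k • scatter x w := by
  simp only [scatter, Finset.smul_sum, Pi.smul_apply, smul_assoc]

theorem isUnit_det_scatter (hS : (scatter x w).PosDef) : IsUnit (scatter x w).det :=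
  (Matrix.isUnit_iff_isUnit_det _).mp hS.isUnit

theorem lev_pos (hS : (scatter x w).PosDef) (hi : x i ≠ 0) : 0 < lev x w i :=
  quad_pos hS.inv hi

theorem lev_smul (hS : (scatter x w).PosDef) {k : ℝ} (hk : k ≠ 0) :
    lev x (k • w) i = lev x w i / k := by
  have := invertibleOfNonzero hk
  rw [lev, scatter_smul, Matrix.inv_smul _ _ (isUnit_det_scatter hS), quad, Matrix.smul_mulVec,
    dotProduct_smul, invOf_eq_inv, smul_eq_mul, inv_mul_eq_div, lev, quad]

-- `xᵢ` is expanded along the sample by inserting `S S⁻¹`, where `S = scatter x w`.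
theorem cross_eq_sum (hS : (scatter x w).PosDef) (i k : Fin n) :
    cross x w' k i = ∑ j, w j * (cross x w' k j * cross x w i j) := by
  rw [cross, dotProduct_comm, ← Matrix.one_mulVec (x i).ofLp,
    ← Matrix.mul_nonsing_inv _ (isUnit_det_scatter hS), ← Matrix.mulVec_mulVec,
    dotProduct_scatter_mulVec]
  rfl

theorem sum_mul_cross_sq (hS : (scatter x w).PosDef) (i : Fin n) :
    ∑ j, w j * cross x w i j ^ 2 = lev x w i := by
  simp only [← cross_self, cross_eq_sum hS i i, sq]

theorem sum_cross_sq (hS : (scatter x 1).PosDef) (i : Fin n) :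
    ∑ j, cross x 1 i j ^ 2 = lev x 1 i := by
  simpa using sum_mul_cross_sq hS i

theorem sq_lev_le (hS : (scatter x w).PosDef) (hw : ∀ i, 0 ≤ w i) :
    lev x w' i ^ 2 ≤ (∑ j, w j * cross x w' i j ^ 2) * lev x w i := by
  rw [← sum_mul_cross_sq hS, ← cross_self, cross_eq_sum hS i i]
  exact Finset.sum_sq_le_sum_mul_sum_of_sq_le_mul _
    (fun j _ => mul_nonneg (hw j) (sq_nonneg _)) (fun j _ => mul_nonneg (hw j) (sq_nonneg _))
    fun j _ => le_of_eq (by ring)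

theorem lev_le_of_le_mul (hS : (scatter x w).PosDef) (hS' : (scatter x w').PosDef)
    (hw' : ∀ i, 0 ≤ w' i) {l : ℝ} (hl₀ : 0 ≤ l) (hl : ∀ i, w' i ≤ l * w i) :
    lev x w i ≤ l * lev x w' i := by
  have h0' : 0 ≤ lev x w' i := quad_nonneg hS'.inv.posSemidef _
  refine le_of_sq_le_mul ?_ (mul_nonneg hl₀ h0')
  calc lev x w i ^ 2 ≤ (∑ j, w' j * cross x w i j ^ 2) * lev x w' i := sq_lev_le hS' hw'
    _ ≤ (∑ j, l * w j * cross x w i j ^ 2) * lev x w' i := by gcongr; exact hl _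
    _ = lev x w i * (l * lev x w' i) := by
      simp_rw [mul_assoc, ← Finset.mul_sum, sum_mul_cross_sq hS]
      ring

theorem lev_le_sum_div (hS : (scatter x 1).PosDef) (hw : ∀ i, 0 < w i) :
    lev x w i ≤ ∑ j, cross x 1 i j ^ 2 / w j := by
  refine le_of_sq_le_mul ?_ (Finset.sum_nonneg fun j _ => div_nonneg (sq_nonneg _) (hw j).le)
  nth_rewrite 2 [← sum_mul_cross_sq (posDef_scatter hS hw)]
  rw [← cross_self, cross_eq_sum hS i i]
  refine Finset.sum_sq_le_sum_mul_sum_of_sq_le_mul _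
    (fun j _ => mul_nonneg (hw j).le (sq_nonneg _)) (fun j _ => div_nonneg (sq_nonneg _) (hw j).le)
    fun j _ => le_of_eq ?_
  have := (hw j).ne'
  rw [Pi.one_apply]
  field_simp

theorem lev_one_le_one (hS : (scatter x 1).PosDef) : lev x 1 i ≤ 1 := by
  refine le_of_sq_le_mul ?_ zero_le_one
  rw [mul_one]
  nth_rewrite 2 [← sum_cross_sq hS]
  exact Finset.single_le_sum (f := fun j => cross x 1 i j ^ 2) (fun j _ => sq_nonneg _)
    (Finset.mem_univ i)

theorem sum_mul_lev (hS : (scatter x w).PosDef) : ∑ i, w i * lev x w i = p := by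
  have htrace : ∀ i, w i * lev x w i = ((w i • outer (x i)) * (scatter x w)⁻¹).trace := by
    intro i
    rw [Matrix.smul_mul, Matrix.trace_smul, smul_eq_mul, outer, Matrix.vecMulVec_mul,
      Matrix.trace_vecMulVec, dotProduct_comm, lev, quad, Matrix.dotProduct_mulVec]
  simp_rw [htrace]
  rw [← Matrix.trace_sum, ← Finset.sum_mul, ← scatter,
    Matrix.mul_nonsing_inv _ (isUnit_det_scatter hS), Matrix.trace_one, Fintype.card_fin]

end Scatter

section WeightSolution

variable {n p : ℕ} {u : ℝ → ℝ} {x : Fin n → EuclideanSpace ℝ (Fin p)} {w : Fin n → ℝ}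

/-- `w` is a positive solution of the system `wᵢ = u (xᵢᵀ S⁻¹ xᵢ)`, `S = ∑ⱼ wⱼ xⱼ xⱼᵀ`, which says
that `S` is an M-estimator of scatter and that `w` is its vector of weights. -/
def IsWeightSolution (u : ℝ → ℝ) (x : Fin n → EuclideanSpace ℝ (Fin p)) (w : Fin n → ℝ) : Prop :=
  ∀ i, 0 < w i ∧ w i = u (lev x w i)

theorem isMEstimator_iff (hS : (scatter x 1).PosDef) (hx : ∀ i, x i ≠ 0)
    (hu : ∀ t, 0 < t → 0 < u t) {S : Matrix (Fin p) (Fin p) ℝ} :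
    IsMEstimator u x S ↔ ∃ w, IsWeightSolution u x w ∧ S = scatter x w := by
  constructor
  · rintro ⟨hpos, hS⟩
    have hscatter : S = scatter x fun i => u (quad S⁻¹ (x i)) := hS
    refine ⟨_, fun i => ⟨hu _ (quad_pos hpos.inv (hx i)), ?_⟩, hscatter⟩
    rw [lev, ← hscatter]
  · rintro ⟨w, hw, rfl⟩
    refine ⟨posDef_scatter hS fun i => (hw i).1, ?_⟩
    change ∑ i, w i • outer (x i) = ∑ i, u (lev x w i) • outer (x i)
    simp_rw [← (hw _).2]

theorem existsUnique_isMEstimator (hS : (scatter x 1).PosDef) (hx : ∀ i, x i ≠ 0)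
    (hu : ∀ t, 0 < t → 0 < u t) (hw : ∃! w, IsWeightSolution u x w) :
    ∃! S, IsMEstimator u x S := by
  simp_rw [isMEstimator_iff hS hx hu]
  obtain ⟨w, hsol, huniq⟩ := hw
  refine ⟨scatter x w, ⟨w, hsol, rfl⟩, ?_⟩
  rintro _ ⟨w', hsol', rfl⟩
  rw [huniq w' hsol']

/-- The logarithm of the leverage as a function of the logarithms `a` of the weights. -/
noncomputable def logLev (x : Fin n → EuclideanSpace ℝ (Fin p)) (a : Fin n → ℝ) (i : Fin n) : ℝ :=
  Real.log (lev x (fun j => Real.exp (a j)) i)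

/-- The fixed point iteration `wᵢ ↦ u (xᵢᵀ S⁻¹ xᵢ)` for the weights, in logarithmic coordinates. -/
noncomputable def weightMap (u : ℝ → ℝ) (x : Fin n → EuclideanSpace ℝ (Fin p)) (a : Fin n → ℝ)
    (i : Fin n) : ℝ :=
  logWeight u (logLev x a i)

theorem logLev_sub_le (hS : (scatter x 1).PosDef) {i : Fin n} (hi : x i ≠ 0) (a b : Fin n → ℝ) :
    logLev x a i - logLev x b i ≤ dist a b := by
  have hSa := posDef_scatter hS fun j => Real.exp_pos (a j)
  have hSb := posDef_scatter hS fun j => Real.exp_pos (b j)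
  have hle : lev x (fun j => Real.exp (a j)) i ≤
      Real.exp (dist a b) * lev x (fun j => Real.exp (b j)) i := by
    refine lev_le_of_le_mul hSa hSb (fun j => (Real.exp_pos _).le) (Real.exp_pos _).le fun j => ?_
    rw [← Real.exp_add, Real.exp_le_exp]
    have := (Real.le_norm_self _).trans (norm_le_pi_norm (b - a) j)
    rw [← dist_eq_norm, dist_comm, Pi.sub_apply] at this
    linarith
  have hlog := Real.log_le_log (lev_pos hSa hi) hle
  rw [Real.log_mul (Real.exp_pos _).ne' (lev_pos hSb hi).ne', Real.log_exp] at hlog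
  rwa [sub_le_iff_le_add]

theorem dist_logLev_le (hS : (scatter x 1).PosDef) {i : Fin n} (hi : x i ≠ 0) (a b : Fin n → ℝ) :
    dist (logLev x a i) (logLev x b i) ≤ dist a b := by
  rw [Real.dist_eq, abs_sub_le_iff]
  exact ⟨logLev_sub_le hS hi a b, dist_comm a b ▸ logLev_sub_le hS hi b a⟩

theorem logLev_const (hS : (scatter x 1).PosDef) {i : Fin n} (hi : x i ≠ 0) (b : ℝ) :
    logLev x (fun _ => b) i = Real.log (lev x 1 i) - b := by
  have hconst : (fun _ : Fin n => Real.exp b) = Real.exp b • (1 : Fin n → ℝ) := by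
    ext
    simp
  rw [logLev, hconst, lev_smul hS (Real.exp_pos b).ne', Real.log_div (lev_pos hS hi).ne'
    (Real.exp_pos b).ne', Real.log_exp]

theorem exp_weightMap (hS : (scatter x 1).PosDef) (hx : ∀ i, x i ≠ 0)
    (hu : ∀ t, 0 < t → 0 < u t) (a : Fin n → ℝ) (i : Fin n) :
    Real.exp (weightMap u x a i) = u (lev x (fun j => Real.exp (a j)) i) := by
  have hlev := lev_pos (posDef_scatter hS fun j => Real.exp_pos (a j)) (hx i)
  rw [weightMap, logLev, logWeight_log u hlev, Real.exp_log (hu _ hlev)]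

theorem isWeightSolution_exp_iff (hS : (scatter x 1).PosDef) (hx : ∀ i, x i ≠ 0)
    (hu : ∀ t, 0 < t → 0 < u t) (a : Fin n → ℝ) :
    IsWeightSolution u x (fun i => Real.exp (a i)) ↔ Function.IsFixedPt (weightMap u x) a := by
  simp_rw [IsWeightSolution, ← exp_weightMap hS hx hu, Real.exp_pos, true_and, Real.exp_eq_exp,
    Function.IsFixedPt, funext_iff, eq_comm]

theorem AdmissibleWeight.dist_weightMap_lt (hu : AdmissibleWeight u) (hS : (scatter x 1).PosDef)
    (hx : ∀ i, x i ≠ 0) (a b : Fin n → ℝ) (hab : a ≠ b) :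
    dist (weightMap u x a) (weightMap u x b) < dist a b := by
  rw [dist_pi_lt_iff (dist_pos.mpr hab)]
  intro i
  rcases eq_or_ne (logLev x a i) (logLev x b i) with h | h
  · simpa [weightMap, h] using hab
  · exact (hu.dist_logWeight_lt _ _ h).trans_le (dist_logLev_le hS (hx i) a b)

theorem existsUnique_isWeightSolution_of_isFixedPt (hu : AdmissibleWeight u)
    (hS : (scatter x 1).PosDef) (hx : ∀ i, x i ≠ 0) {a : Fin n → ℝ}
    (ha : Function.IsFixedPt (weightMap u x) a) : ∃! w, IsWeightSolution u x w := by
  have hiff := isWeightSolution_exp_iff (u := u) hS hx fun _ => hu.pos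
  refine ⟨_, (hiff a).mpr ha, fun w hw => ?_⟩
  have hexp : (fun i => Real.exp (Real.log (w i))) = w := funext fun i => Real.exp_log (hw i).1
  rw [← hexp] at hw ⊢
  have hb := (hiff _).mp hw
  by_contra hne
  have hlt := hu.dist_weightMap_lt hS hx (fun i => Real.log (w i)) a fun h => hne (by simp [← h])
  rw [hb, ha] at hlt
  exact lt_irrefl _ hlt

end WeightSolution

section Existence

variable {u : ℝ → ℝ} {t r η : ℝ} {n p : ℕ} {x : Fin n → EuclideanSpace ℝ (Fin p)}

-- Under the constant weights `u t` the leverages are `lev x 1 i / u t`, close to `ψ t / u t = t`.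
theorem mapsTo_weightMap_closedBall (ht : 0 < t) (hut : 0 < u t) (hr : 0 ≤ r)
    (hu : Set.MapsTo (logWeight u) (Metric.closedBall (Real.log t) (r + η))
      (Metric.closedBall (logWeight u (Real.log t)) r))
    (hS : (scatter x 1).PosDef) (hx : ∀ i, x i ≠ 0)
    (hlev : ∀ i, |Real.log (lev x 1 i) - Real.log (psi u t)| ≤ η) :
    Set.MapsTo (weightMap u x) (Metric.closedBall (fun _ => Real.log (u t)) r)
      (Metric.closedBall (fun _ => Real.log (u t)) r) := by
  intro a ha
  rw [Metric.mem_closedBall, dist_pi_le_iff hr]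
  intro i
  rw [← logWeight_log u ht]
  refine hu ?_
  have hconst : dist (logLev x (fun _ => Real.log (u t)) i) (Real.log t) ≤ η := by
    convert hlev i using 1
    rw [Real.dist_eq, logLev_const hS (hx i), psi, Real.log_mul ht.ne' hut.ne', sub_sub, add_comm]
  exact (dist_triangle _ _ _).trans
    (add_le_add ((dist_logLev_le hS (hx i) _ _).trans ha) hconst)

theorem AdmissibleWeight.existsUnique_isWeightSolution (hu : AdmissibleWeight u) (ht : 0 < t) :
    ∃ η, 0 < η ∧ ∀ (n p : ℕ) (x : Fin n → EuclideanSpace ℝ (Fin p)), (scatter x 1).PosDef →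
      (∀ i, x i ≠ 0) → (∀ i, |Real.log (lev x 1 i) - Real.log (psi u t)| ≤ η) →
      ∃! w, IsWeightSolution u x w := by
  obtain ⟨η, hη, hmaps⟩ := exists_mapsTo_closedBall_add hu.dist_logWeight_lt (Real.log t) one_pos
  refine ⟨η, hη, fun n p x hS hx hlev => ?_⟩
  obtain ⟨a, -, ha⟩ := exists_isFixedPt_of_dist_lt (isCompact_closedBall _ _)
    (Metric.nonempty_closedBall.mpr zero_le_one)
    (mapsTo_weightMap_closedBall ht (hu.pos ht) zero_le_one hmaps hS hx hlev)
    (hu.dist_weightMap_lt hS hx)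
  exact existsUnique_isWeightSolution_of_isFixedPt hu hS hx ha

end Existence

section MassLoss

variable {ι : Type*} [Fintype ι] {q q' f w : ι → ℝ} {κ m M : ℝ} {J : Finset ι}

theorem sum_mul_le_mul_exp (hq : ∀ j, 0 ≤ q j) (hq₁ : ∑ j, q j ≤ 1) (hκ : 0 ≤ κ)
    (hJ : ∀ j ∈ J, κ ≤ q j) (hf : ∀ j, f j ≤ 1) :
    ∑ j, q j * f j ≤ (∑ j, q j) * Real.exp (-(κ * ∑ j ∈ J, (1 - f j))) := by
  have hf' : ∀ j, 0 ≤ 1 - f j := fun j => sub_nonneg.mpr (hf j)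
  have hQ : 0 ≤ ∑ j, q j := Finset.sum_nonneg fun j _ => hq j
  have hdefect : κ * ∑ j ∈ J, (1 - f j) ≤ ∑ j, q j - ∑ j, q j * f j := by
    rw [Finset.mul_sum, ← Finset.sum_sub_distrib]
    calc ∑ j ∈ J, κ * (1 - f j) ≤ ∑ j ∈ J, q j * (1 - f j) :=
          Finset.sum_le_sum fun j hj => mul_le_mul_of_nonneg_right (hJ j hj) (hf' j)
      _ ≤ ∑ j, q j * (1 - f j) :=
          Finset.sum_le_univ_sum_of_nonneg fun j => mul_nonneg (hq j) (hf' j)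
      _ = ∑ j, (q j - q j * f j) := by simp only [mul_sub, mul_one]
  have hD : 0 ≤ κ * ∑ j ∈ J, (1 - f j) := mul_nonneg hκ (Finset.sum_nonneg fun j _ => hf' j)
  calc ∑ j, q j * f j ≤ (∑ j, q j) * (1 - κ * ∑ j ∈ J, (1 - f j)) := by
        linarith [mul_le_of_le_one_left hD hq₁]
    _ ≤ _ := mul_le_mul_of_nonneg_left (Real.one_sub_le_exp_neg _) hQ

-- If `w` is close to `m` at `j` then it is far below `M`: on `J` one of the two sums loses mass.
theorem sum_div_mul_sum_mul_le (hq : ∀ j, 0 ≤ q j) (hq₁ : ∑ j, q j ≤ 1) (hq' : ∀ j, 0 ≤ q' j)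
    (hq₁' : ∑ j, q' j ≤ 1) (hκ : 0 ≤ κ) (hJ : ∀ j ∈ J, κ ≤ q j ∧ κ ≤ q' j) (hm : 0 < m)
    (hmw : ∀ j, m ≤ w j) (hwM : ∀ j, w j ≤ M) (hM : 0 < M) :
    (∑ j, q j * (m / w j)) * ∑ j, q' j * (w j / M) ≤
      (∑ j, q j) * (∑ j, q' j) * Real.exp (-(κ * (J.card * (1 - m / M)))) := by
  have hw : ∀ j, 0 < w j := fun j => hm.trans_le (hmw j)
  have hlow : ∀ j, m / w j ≤ 1 := fun j => (div_le_one (hw j)).mpr (hmw j)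
  have hup : ∀ j, w j / M ≤ 1 := fun j => (div_le_one hM).mpr (hwM j)
  have hloss : ∀ j, 1 - m / M ≤ (1 - m / w j) + (1 - w j / M) := fun j => by
    have := mul_nonneg (sub_nonneg.mpr (hlow j)) (sub_nonneg.mpr (hup j))
    have := div_mul_div_cancel₀ (a := m) (c := M) (hw j).ne'
    linarith
  have hcard : J.card * (1 - m / M) ≤ ∑ j ∈ J, (1 - m / w j) + ∑ j ∈ J, (1 - w j / M) := by
    rw [← Finset.sum_add_distrib, ← nsmul_eq_mul]
    exact Finset.card_nsmul_le_sum _ _ _ fun j _ => hloss j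
  have hpos' : 0 ≤ ∑ j, q' j * (w j / M) :=
    Finset.sum_nonneg fun j _ => mul_nonneg (hq' j) (div_pos (hw j) hM).le
  have hQ : 0 ≤ ∑ j, q j := Finset.sum_nonneg fun j _ => hq j
  have hQ' : 0 ≤ ∑ j, q' j := Finset.sum_nonneg fun j _ => hq' j
  calc _ ≤ ((∑ j, q j) * Real.exp (-(κ * ∑ j ∈ J, (1 - m / w j)))) *
        ((∑ j, q' j) * Real.exp (-(κ * ∑ j ∈ J, (1 - w j / M)))) :=
      mul_le_mul (sum_mul_le_mul_exp hq hq₁ hκ (fun j hj => (hJ j hj).1) hlow)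
        (sum_mul_le_mul_exp hq' hq₁' hκ (fun j hj => (hJ j hj).2) hup) hpos' (by positivity)
    _ = (∑ j, q j) * (∑ j, q' j) *
        Real.exp (-(κ * (∑ j ∈ J, (1 - m / w j) + ∑ j ∈ J, (1 - w j / M)))) := by
      rw [mul_mul_mul_comm, ← Real.exp_add, mul_add, neg_add]
    _ ≤ _ := by gcongr

end MassLoss

section Oscillation

variable {n p : ℕ} {x : Fin n → EuclideanSpace ℝ (Fin p)} {w : Fin n → ℝ} {c m M r : ℝ}

/-- The mass of every row of the squared hat matrix is spread out: at least three quarters of its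
entries are at least `c / n`, a fixed proportion of their average size. In particular any two rows
are simultaneously large at half of the columns. -/
def Spread (x : Fin n → EuclideanSpace ℝ (Fin p)) (c : ℝ) : Prop :=
  ∀ i, 3 / 4 * (n : ℝ) ≤ (Finset.univ.filter fun j => c / n ≤ cross x 1 i j ^ 2).card

theorem Spread.exists_common (hx : Spread x c) (i k : Fin n) : ∃ J : Finset (Fin n),
    (n : ℝ) / 2 ≤ J.card ∧ ∀ j ∈ J, c / n ≤ cross x 1 i j ^ 2 ∧ c / n ≤ cross x 1 k j ^ 2 := by
  set A : Fin n → Finset (Fin n) := fun i => {j | c / n ≤ cross x 1 i j ^ 2}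
  refine ⟨A i ∩ A k, ?_, fun j hj => by simpa [A] using hj⟩
  have hunion : ((A i ∪ A k).card : ℝ) ≤ n := by
    exact_mod_cast (Finset.card_le_univ _).trans_eq (Fintype.card_fin n)
  have hinter : ((A i ∪ A k).card : ℝ) + (A i ∩ A k).card = (A i).card + (A k).card := by
    exact_mod_cast Finset.card_union_add_card_inter _ _
  have hi : 3 / 4 * (n : ℝ) ≤ (A i).card := hx i
  have hk : 3 / 4 * (n : ℝ) ≤ (A k).card := hx k
  linarith

theorem lev_mul_sq_lev_one_le (hS : (scatter x 1).PosDef) (hw : ∀ i, 0 < w i) (hm : m ≠ 0)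
    (hM : M ≠ 0) (i k : Fin n) :
    lev x w i * lev x 1 k ^ 2 ≤ M / m * lev x w k *
      ((∑ j, cross x 1 i j ^ 2 * (m / w j)) * ∑ j, cross x 1 k j ^ 2 * (w j / M)) := by
  have hSw := posDef_scatter hS hw
  have hi : lev x w i ≤ (∑ j, cross x 1 i j ^ 2 * (m / w j)) / m := by
    refine (lev_le_sum_div hS hw).trans_eq ?_
    rw [Finset.sum_div]
    exact Finset.sum_congr rfl fun j _ => by field_simp
  have hk : lev x 1 k ^ 2 ≤ (∑ j, cross x 1 k j ^ 2 * (w j / M)) * M * lev x w k := by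
    refine (sq_lev_le hSw fun i => (hw i).le).trans_eq ?_
    congr 1
    rw [Finset.sum_mul]
    exact Finset.sum_congr rfl fun j _ => by field_simp
  calc _ ≤ _ := mul_le_mul hi hk (sq_nonneg _) ((quad_nonneg hSw.inv.posSemidef _).trans hi)
    _ = _ := by ring

theorem lev_mul_lev_one_le (hS : (scatter x 1).PosDef) (hn : 0 < n) (hc : 0 ≤ c) (hx : Spread x c)
    (hx₀ : ∀ i, x i ≠ 0) (hm : 0 < m) (hmw : ∀ i, m ≤ w i) (hwM : ∀ i, w i ≤ M) (i k : Fin n) :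
    lev x w i * lev x 1 k ≤
      M / m * (lev x 1 i * lev x w k) * Real.exp (-(c / 2 * (1 - m / M))) := by
  have hw : ∀ i, 0 < w i := fun i => hm.trans_le (hmw i)
  have hM : 0 < M := (hw i).trans_le (hwM i)
  have hlevk : 0 < lev x w k := lev_pos (posDef_scatter hS hw) (hx₀ k)
  have hlev1 : ∀ i, 0 < lev x 1 i := fun i => lev_pos hS (hx₀ i)
  obtain ⟨J, hJcard, hJ⟩ := hx.exists_common i k
  have hsum : ∀ i, ∑ j, cross x 1 i j ^ 2 ≤ 1 := fun i => (sum_cross_sq hS i).trans_le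
    (lev_one_le_one hS)
  have hprod := sum_div_mul_sum_mul_le (fun j => sq_nonneg (cross x 1 i j)) (hsum i)
    (fun j => sq_nonneg (cross x 1 k j)) (hsum k) (by positivity) hJ hm hmw hwM hM
  rw [sum_cross_sq hS, sum_cross_sq hS] at hprod
  have hexp : c / 2 * (1 - m / M) ≤ c / n * (J.card * (1 - m / M)) := by
    have : 0 ≤ 1 - m / M := sub_nonneg.mpr ((div_le_one hM).mpr ((hmw i).trans (hwM i)))
    have : (0 : ℝ) < n := by exact_mod_cast hn
    calc c / 2 * (1 - m / M) = c / n * ((n / 2) * (1 - m / M)) := by field_simp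
      _ ≤ _ := by gcongr
  refine le_of_mul_le_mul_right ?_ (hlev1 k)
  calc lev x w i * lev x 1 k * lev x 1 k = lev x w i * lev x 1 k ^ 2 := by ring
    _ ≤ M / m * lev x w k * ((∑ j, cross x 1 i j ^ 2 * (m / w j)) *
        ∑ j, cross x 1 k j ^ 2 * (w j / M)) := lev_mul_sq_lev_one_le hS hw hm.ne' hM.ne' i k
    _ ≤ M / m * lev x w k * (lev x 1 i * lev x 1 k *
        Real.exp (-(c / n * (J.card * (1 - m / M))))) := by gcongr
    _ = M / m * (lev x 1 i * lev x w k) *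
        Real.exp (-(c / n * (J.card * (1 - m / M)))) * lev x 1 k := by ring
    _ ≤ _ := by
      have := hlev1 i
      have := hlev1 k
      gcongr

theorem log_lev_sub_log_lev_le (hS : (scatter x 1).PosDef) (hn : 0 < n) (hc : 0 ≤ c)
    (hx : Spread x c) (hx₀ : ∀ i, x i ≠ 0) (hm : 0 < m) (hmw : ∀ i, m ≤ w i)
    (hwM : ∀ i, w i ≤ M) (i k : Fin n) :
    Real.log (lev x w i) - Real.log (lev x w k) ≤
      Real.log M - Real.log m + (Real.log (lev x 1 i) - Real.log (lev x 1 k)) -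
        c / 2 * (1 - m / M) := by
  have hSw := posDef_scatter hS fun i => hm.trans_le (hmw i)
  have hM : 0 < M := hm.trans_le ((hmw i).trans (hwM i))
  have hlev : ∀ i, 0 < lev x w i := fun i => lev_pos hSw (hx₀ i)
  have hlev1 : ∀ i, 0 < lev x 1 i := fun i => lev_pos hS (hx₀ i)
  have h := Real.log_le_log (mul_pos (hlev i) (hlev1 k))
    (lev_mul_lev_one_le hS hn hc hx hx₀ hm hmw hwM i k)
  rw [Real.log_mul (hlev i).ne' (hlev1 k).ne',
    Real.log_mul (mul_pos (div_pos hM hm) (mul_pos (hlev1 i) (hlev k))).ne' (Real.exp_pos _).ne',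
    Real.log_mul (div_pos hM hm).ne' (mul_pos (hlev1 i) (hlev k)).ne',
    Real.log_mul (hlev1 i).ne' (hlev k).ne', Real.log_div hM.ne' hm.ne', Real.log_exp] at h
  linarith

theorem log_sub_log_le_two_mul {a b : ℝ} (ha : 0 < a) (hba : b ≤ a) (hb : 1 / 2 ≤ b / a) :
    Real.log a - Real.log b ≤ 2 * (1 - b / a) := by
  have hb' : 0 < b / a := one_half_pos.trans_le hb
  have h := log_sub_log_le hb' one_pos
  rw [Real.log_one, Real.log_div (pos_of_mul_pos_left hb' (inv_pos.mpr ha).le).ne' ha.ne',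
    zero_sub, neg_sub] at h
  refine h.trans ((div_le_iff₀ hb').mpr ?_)
  nlinarith [sub_nonneg.mpr ((div_le_one ha).mpr hba)]

-- `u` does not increase logarithmic oscillation, so the loss `c / 2 * (1 - m / M)` cannot exceed
-- the oscillation `r` of the unweighted leverages; hence `m / M` is close to `1`.
theorem IsWeightSolution.log_lev_sub_le {u : ℝ → ℝ} (hw : IsWeightSolution u x w)
    (hu : AdmissibleWeight u) (hS : (scatter x 1).PosDef) (hx₀ : ∀ i, x i ≠ 0) (hc : 0 < c)
    (hx : Spread x c) (hr : ∀ i k, Real.log (lev x 1 i) - Real.log (lev x 1 k) ≤ r)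
    (hrc : r ≤ c / 4) (i k : Fin n) :
    Real.log (lev x w i) - Real.log (lev x w k) ≤ r + 4 * r / c := by
  have : Nonempty (Fin n) := ⟨i⟩
  obtain ⟨a, ha⟩ := Finite.exists_max w
  obtain ⟨b, hb⟩ := Finite.exists_min w
  have hlev : ∀ i, 0 < lev x w i := fun i =>
    lev_pos (posDef_scatter hS fun i => (hw i).1) (hx₀ i)
  have hratio : ∀ i k, Real.log (lev x w i) - Real.log (lev x w k) ≤
      Real.log (w a) - Real.log (w b) + r - c / 2 * (1 - w b / w a) := fun i k => by
    have := log_lev_sub_log_lev_le hS i.pos hc.le hx hx₀ (hw b).1 hb ha i k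
    linarith [hr i k]
  have hosc : Real.log (w a) - Real.log (w b) ≤
      Real.log (w a) - Real.log (w b) + r - c / 2 * (1 - w b / w a) := by
    have h := hu.abs_log_sub_log_le (hlev a) (hlev b)
    rw [← (hw a).2, ← (hw b).2] at h
    exact (le_abs_self _).trans (h.trans (abs_sub_le_iff.mpr ⟨hratio a b, hratio b a⟩))
  have hz : 1 - w b / w a ≤ 2 * r / c := by
    rw [le_div_iff₀ hc]
    linarith
  have hz' : 2 * r / c ≤ 1 / 2 := by
    rw [div_le_iff₀ hc]
    linarith
  have hlog := log_sub_log_le_two_mul (hw a).1 (hb a) (by linarith)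
  have hloss : 0 ≤ c / 2 * (1 - w b / w a) :=
    mul_nonneg (by positivity) (sub_nonneg.mpr ((div_le_one (hw a).1).mpr (hb a)))
  calc _ ≤ _ := hratio i k
    _ ≤ r + 2 * (2 * r / c) := by linarith
    _ = r + 4 * r / c := by ring

end Oscillation

section Closeness

variable {n p : ℕ} {u : ℝ → ℝ} {x : Fin n → EuclideanSpace ℝ (Fin p)} {w : Fin n → ℝ} {y : ℝ}

-- The average of `ψ (lev x w i) = wᵢ (lev x w i)` over `i` is `tr (S⁻¹ S) / n = p / n`.
theorem IsWeightSolution.exists_psi_lev_le_and_ge (hw : IsWeightSolution u x w)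
    (hS : (scatter x w).PosDef) (hn : 0 < n) :
    (∃ j, psi u (lev x w j) ≤ p / n) ∧ ∃ k, (p : ℝ) / n ≤ psi u (lev x w k) := by
  have hsum : ∑ i, psi u (lev x w i) = ∑ _i : Fin n, (p : ℝ) / n := by
    have hn' : (n : ℝ) ≠ 0 := by exact_mod_cast hn.ne'
    simp_rw [psi, ← (hw _).2, mul_comm _ (w _)]
    rw [sum_mul_lev hS, Finset.sum_const, Finset.card_univ, Fintype.card_fin, nsmul_eq_mul,
      mul_div_cancel₀ _ hn']
  have hne : (Finset.univ : Finset (Fin n)).Nonempty := ⟨⟨0, hn⟩, Finset.mem_univ _⟩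
  obtain ⟨j, -, hj⟩ := Finset.exists_le_of_sum_le hne hsum.le
  obtain ⟨k, -, hk⟩ := Finset.exists_le_of_sum_le hne hsum.ge
  exact ⟨⟨j, hj⟩, k, hk⟩

theorem AdmissibleWeight.exists_abs_log_lev_sub_le (hu : AdmissibleWeight u)
    (hy : y ∈ psi u '' Set.Ici 0) (hy₀ : 0 < y) {ε : ℝ} (hε : 0 < ε) :
    ∃ δ, 0 < δ ∧ ∀ (n p : ℕ) (x : Fin n → EuclideanSpace ℝ (Fin p)) (w : Fin n → ℝ) (s : ℝ),
      0 < n → |(p : ℝ) / n - y| < δ → IsWeightSolution u x w → (scatter x w).PosDef →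
      (∀ i, x i ≠ 0) → (∀ i k, Real.log (lev x w i) - Real.log (lev x w k) ≤ s) →
      ∀ i, |Real.log (lev x w i) - Real.log (psiInv u y)| ≤ ε + s := by
  obtain ⟨δ, hδ, hψ⟩ := hu.exists_log_psiInv_bounds hy hy₀ hε
  refine ⟨δ, hδ, fun n p x w s hn hp hw hS hx hs i => ?_⟩
  obtain ⟨⟨j, hj⟩, k, hk⟩ := hw.exists_psi_lev_le_and_ge hS hn
  rw [abs_lt] at hp
  have hj' := (hψ _ (lev_pos hS (hx j))).1 (by linarith)
  have hk' := (hψ _ (lev_pos hS (hx k))).2 (by linarith)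
  rw [abs_le]
  constructor <;> linarith [hs i j, hs k i]

end Closeness

section OpNorm

variable {n p : ℕ}

/-- The design map `v ↦ (⟪xᵢ, v⟫)ᵢ` of the vectors `xᵢ`. -/
noncomputable def design {F ι : Type*} [Fintype ι] [NormedAddCommGroup F] [InnerProductSpace ℝ F]
    (x : ι → F) : F →L[ℝ] EuclideanSpace ℝ ι :=
  (EuclideanSpace.equiv ι ℝ).symm.toContinuousLinearMap ∘L
    ContinuousLinearMap.pi fun i => innerSL ℝ (x i)

theorem design_apply {F ι : Type*} [Fintype ι] [NormedAddCommGroup F] [InnerProductSpace ℝ F]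
    (x : ι → F) (v : F) (i : ι) : design x v i = inner ℝ (x i) v := rfl

theorem inner_design_mul_le {F ι : Type*} [Fintype ι] [NormedAddCommGroup F]
    [InnerProductSpace ℝ F] (x : ι → F) {w : ι → ℝ} {κ : ℝ} (hw : ∀ i, |w i| ≤ κ) (a b : F) :
    ∑ i, w i * (inner ℝ (x i) a * inner ℝ (x i) b) ≤ κ * (‖design x a‖ * ‖design x b‖) := by
  calc ∑ i, w i * (inner ℝ (x i) a * inner ℝ (x i) b)
      ≤ ∑ i, κ * (|design x a i| * |design x b i|) := by
        refine Finset.sum_le_sum fun i _ => (le_abs_self _).trans ?_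
        rw [abs_mul, abs_mul]
        exact mul_le_mul_of_nonneg_right (hw i) (by positivity)
    _ = κ * ∑ i, |design x a i| * |design x b i| := by rw [Finset.mul_sum]
    _ ≤ κ * (‖design x a‖ * ‖design x b‖) := by
        rcases isEmpty_or_nonempty ι with hι | ⟨⟨i⟩⟩
        · simp [EuclideanSpace.norm_eq]
        · refine mul_le_mul_of_nonneg_left ?_ ((abs_nonneg _).trans (hw i))
          simp_rw [EuclideanSpace.norm_eq, Real.norm_eq_abs]
          exact Real.sum_mul_le_sqrt_mul_sqrt _ _ _

theorem opNorm_scatter_le {x : Fin n → EuclideanSpace ℝ (Fin p)} {w : Fin n → ℝ} {κ : ℝ}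
    (hκ : 0 ≤ κ) (hw : ∀ i, |w i| ≤ κ) : opNorm (scatter x w) ≤ κ * ‖design x‖ ^ 2 := by
  refine ContinuousLinearMap.opNorm_le_of_re_inner_le (by positivity) fun b a hb ha => ?_
  have hle := inner_design_mul_le x hw a b
  have hDa := (design x).le_opNorm a
  have hDb := (design x).le_opNorm b
  rw [ha, mul_one] at hDa
  rw [hb, mul_one] at hDb
  rw [RCLike.re_to_real, real_inner_comm, Matrix.inner_toEuclideanCLM, dotProduct_scatter_mulVec]
  calc _ = ∑ i, w i * (inner ℝ (x i) a * inner ℝ (x i) b) := by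
        simp only [EuclideanSpace.inner_eq_star_dotProduct, star_trivial, dotProduct_comm]
    _ ≤ κ * (‖design x‖ * ‖design x‖) := hle.trans (by gcongr)
    _ = κ * ‖design x‖ ^ 2 := by ring

end OpNorm

section Equivariance

open Matrix

variable {n p : ℕ} {u : ℝ → ℝ} {A : Matrix (Fin p) (Fin p) ℝ}
  {x : Fin n → EuclideanSpace ℝ (Fin p)}

theorem outer_toEuclideanCLM (z : EuclideanSpace ℝ (Fin p)) :
    outer (toEuclideanCLM (𝕜 := ℝ) A z) = A * outer z * Aᵀ := by
  rw [outer, ofLp_toEuclideanCLM, outer, mul_vecMulVec, vecMulVec_mul, vecMul_transpose]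

theorem quad_toEuclideanCLM (M : Matrix (Fin p) (Fin p) ℝ) (z : EuclideanSpace ℝ (Fin p)) :
    quad M (toEuclideanCLM (𝕜 := ℝ) A z) = quad (Aᵀ * M * A) z := by
  rw [quad, ofLp_toEuclideanCLM, quad, ← mulVec_mulVec, ← mulVec_mulVec, dotProduct_mulVec _ Aᵀ,
    vecMul_transpose]

theorem sampleCov_toEuclideanCLM :
    sampleCov (fun i => toEuclideanCLM (𝕜 := ℝ) A (x i)) = A * sampleCov x * Aᵀ := by
  simp_rw [sampleCov, outer_toEuclideanCLM, ← Finset.sum_mul, ← Finset.mul_sum, Matrix.mul_smul,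
    Matrix.smul_mul]

theorem isMEstimator_toEuclideanCLM_iff (hA : IsUnit A) {S : Matrix (Fin p) (Fin p) ℝ} :
    IsMEstimator u (fun i => toEuclideanCLM (𝕜 := ℝ) A (x i)) (A * S * Aᵀ) ↔
      IsMEstimator u x S := by
  have hAt : IsUnit Aᵀ := (isUnit_transpose A).mpr hA
  have hinv : Aᵀ * (A * S * Aᵀ)⁻¹ * A = S⁻¹ := by
    rw [Matrix.mul_inv_rev, Matrix.mul_inv_rev,
      mul_nonsing_inv_cancel_left _ _ ((isUnit_iff_isUnit_det _).mp hAt),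
      nonsing_inv_mul_cancel_right _ _ ((isUnit_iff_isUnit_det _).mp hA)]
  have hpos : (A * S * Aᵀ).PosDef ↔ S.PosDef := by
    have h := hA.posDef_star_right_conjugate_iff (x := S)
    rwa [star_eq_conjTranspose, conjTranspose_eq_transpose_of_trivial] at h
  have hsum : ∑ i, u (quad (A * S * Aᵀ)⁻¹ (toEuclideanCLM (𝕜 := ℝ) A (x i))) •
      outer (toEuclideanCLM (𝕜 := ℝ) A (x i)) =
        A * (∑ i, u (quad S⁻¹ (x i)) • outer (x i)) * Aᵀ := by
    simp_rw [quad_toEuclideanCLM, hinv, outer_toEuclideanCLM, Finset.mul_sum, Finset.sum_mul,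
      Matrix.mul_smul, Matrix.smul_mul]
  rw [IsMEstimator, hpos, hsum, hAt.mul_left_inj, hA.mul_right_inj, IsMEstimator]

theorem isUnit_sqrt {T : Matrix (Fin p) (Fin p) ℝ} (hT : T.PosDef) : IsUnit (CFC.sqrt T) := by
  have h := hT.isUnit
  rw [← CFC.sqrt_mul_sqrt_self T hT.posSemidef.nonneg] at h
  exact isUnit_of_mul_isUnit_left h

theorem transpose_sqrt (T : Matrix (Fin p) (Fin p) ℝ) : (CFC.sqrt T)ᵀ = CFC.sqrt T := by
  rw [← conjTranspose_eq_transpose_of_trivial]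
  exact (nonneg_iff_posSemidef.mp (CFC.sqrt_nonneg T)).isHermitian

theorem whiten_sqrt_mul_mul_sqrt {T : Matrix (Fin p) (Fin p) ℝ} (hT : T.PosDef)
    (M : Matrix (Fin p) (Fin p) ℝ) : whiten T (CFC.sqrt T * M * CFC.sqrt T) = M := by
  have hdet := (isUnit_iff_isUnit_det _).mp (isUnit_sqrt hT)
  rw [whiten, ← Matrix.mul_assoc, nonsing_inv_mul_cancel_left _ _ hdet,
    mul_nonsing_inv_cancel_right _ _ hdet]

theorem whiten_one (M : Matrix (Fin p) (Fin p) ℝ) : whiten 1 M = M := by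
  simp [whiten]

theorem goodSample_sqrt {y ε : ℝ} {T : Matrix (Fin p) (Fin p) ℝ} (hT : T.PosDef)
    (hx : GoodSample u y 1 ε x) :
    GoodSample u y T ε fun i => toEuclideanCLM (𝕜 := ℝ) (CFC.sqrt T) (x i) := by
  set A := CFC.sqrt T with hA
  have hiff : ∀ S, IsMEstimator u (fun i => toEuclideanCLM (𝕜 := ℝ) A (x i)) (A * S * A) ↔
      IsMEstimator u x S := fun S => by
    simpa only [hA, transpose_sqrt] using isMEstimator_toEuclideanCLM_iff (isUnit_sqrt hT)
  let e : Equiv.Perm (Matrix (Fin p) (Fin p) ℝ) :=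
    (isUnit_sqrt hT).unit.mulLeft.trans (isUnit_sqrt hT).unit.mulRight
  have he : ∀ S, e S = A * S * A := fun S => rfl
  refine ⟨e.existsUnique_congr_right.mp (by simpa only [he, hiff] using hx.1), ?_⟩
  rw [← e.forall_congr_right]
  intro S hS
  rw [he] at hS ⊢
  have hcov := sampleCov_toEuclideanCLM (A := A) (x := x)
  rw [hA, transpose_sqrt, ← hA] at hcov
  rw [hcov, ← Matrix.smul_mul, ← Matrix.mul_smul, ← Matrix.sub_mul, ← Matrix.mul_sub,
    whiten_sqrt_mul_mul_sqrt hT]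
  simpa only [whiten_one] using hx.2 S ((hiff S).mp hS)

end Equivariance

section Regular

variable {n p : ℕ} {u : ℝ → ℝ} {x : Fin n → EuclideanSpace ℝ (Fin p)} {y ε c B : ℝ}

/-- The properties of a sample from which its M-estimator is controlled: the unweighted leverages
are close to `y`, the hat matrix is spread out, and the design matrix has norm of order `√n`. -/
structure IsRegular (x : Fin n → EuclideanSpace ℝ (Fin p)) (y ε c B : ℝ) : Prop where
  posDef : (scatter x 1).PosDef
  abs_lev_sub_le : ∀ i, |lev x 1 i - y| ≤ ε
  spread : Spread x c
  norm_design_sq_le : ‖design x‖ ^ 2 ≤ n * B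

theorem IsRegular.ne_zero (hx : IsRegular x y ε c B) (hεy : ε < y) (i : Fin n) : x i ≠ 0 := by
  intro hi
  have h := (abs_le.mp (hx.abs_lev_sub_le i)).1
  rw [lev, hi, quad, WithLp.ofLp_zero, zero_dotProduct] at h
  linarith

theorem IsRegular.half_le_lev (hx : IsRegular x y ε c B) (hεy : ε ≤ y / 2) (i : Fin n) :
    y / 2 ≤ lev x 1 i := by
  linarith [(abs_le.mp (hx.abs_lev_sub_le i)).1]

theorem AdmissibleWeight.existsUnique_of_isRegular (hu : AdmissibleWeight u)
    (hy : y ∈ psi u '' Set.Ici 0) (hy₀ : 0 < y) :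
    ∃ η, 0 < η ∧ ∀ (n p : ℕ) (x : Fin n → EuclideanSpace ℝ (Fin p)) (c B : ℝ),
      IsRegular x y η c B → ∃! w, IsWeightSolution u x w := by
  obtain ⟨η, hη, hex⟩ := hu.existsUnique_isWeightSolution (psiInv_pos hy hy₀)
  rw [psi_psiInv hy] at hex
  refine ⟨min (y / 2) (η * (y / 2)), by positivity, fun n p x c B hx => ?_⟩
  have hεy := min_le_left (y / 2) (η * (y / 2))
  refine hex n p x hx.posDef (hx.ne_zero (hεy.trans_lt (half_lt_self hy₀))) fun i => ?_
  refine (abs_log_sub_log_le_div (half_pos hy₀) (half_le_self hy₀.le)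
    (hx.half_le_lev hεy i)).trans ?_
  rw [div_le_iff₀ (half_pos hy₀)]
  exact (hx.abs_lev_sub_le i).trans (min_le_right _ _)

theorem IsRegular.log_lev_sub_le (hx : IsRegular x y ε c B) (hy₀ : 0 < y) (hεy : ε ≤ y / 2)
    (i k : Fin n) : Real.log (lev x 1 i) - Real.log (lev x 1 k) ≤ 4 * ε / y := by
  refine (le_abs_self _).trans ((abs_log_sub_log_le_div (half_pos hy₀) (hx.half_le_lev hεy k)
    (hx.half_le_lev hεy i)).trans ?_)
  have hi := abs_le.mp (hx.abs_lev_sub_le i)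
  have hk := abs_le.mp (hx.abs_lev_sub_le k)
  rw [show 4 * ε / y = 2 * ε / (y / 2) by ring]
  gcongr
  rw [abs_le]
  constructor <;> linarith

theorem AdmissibleWeight.exists_abs_weight_div_sub_one_le (hu : AdmissibleWeight u)
    (hy : y ∈ psi u '' Set.Ici 0) (hy₀ : 0 < y) (hc : 0 < c) :
    ∃ K η : ℝ, 0 < K ∧ 0 < η ∧ ∀ ε, 0 < ε → ε < η → ∃ δ, 0 < δ ∧
      ∀ (n p : ℕ) (x : Fin n → EuclideanSpace ℝ (Fin p)) (B : ℝ) (w : Fin n → ℝ), 0 < n →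
        |(p : ℝ) / n - y| < δ → IsRegular x y ε c B → IsWeightSolution u x w →
        ∀ i, |w i / u (psiInv u y) - 1| ≤ K * ε := by
  have ht := psiInv_pos hy hy₀
  have hut := hu.pos ht
  set K := 1 + 4 / y + 16 / (y * c) with hK
  have hK₀ : 0 < K := by positivity
  refine ⟨2 * K, min (y / 2) (min (c * y / 16) (1 / K)), by positivity, by positivity,
    fun ε hε hεη => ?_⟩
  obtain ⟨δ, hδ, hclose⟩ := hu.exists_abs_log_lev_sub_le hy hy₀ hε
  refine ⟨δ, hδ, fun n p x B w hn hp hx hw i => ?_⟩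
  simp only [lt_min_iff] at hεη
  obtain ⟨hεy, hεc, hεK⟩ := hεη
  have hx₀ := hx.ne_zero (hεy.trans (half_lt_self hy₀))
  have hS := posDef_scatter hx.posDef fun i => (hw i).1
  have hrc : 4 * ε / y ≤ c / 4 := by
    rw [div_le_iff₀ hy₀]
    linarith
  have hlev := hclose n p x w _ hn hp hw hS hx₀
    (hw.log_lev_sub_le hu hx.posDef hx₀ hc hx.spread (hx.log_lev_sub_le hy₀ hεy.le) hrc) i
  have hlog : |Real.log (w i / u (psiInv u y))| ≤ K * ε := by
    rw [Real.log_div (hw i).1.ne' hut.ne']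
    nth_rewrite 1 [(hw i).2]
    refine (hu.abs_log_sub_log_le (lev_pos hS (hx₀ i)) ht).trans (hlev.trans_eq ?_)
    rw [hK]
    field_simp
    ring
  have hone : K * ε ≤ 1 := by
    rw [lt_div_iff₀ hK₀] at hεK
    linarith
  have hexp := Real.abs_exp_sub_one_le (hlog.trans hone)
  rw [Real.exp_log (div_pos (hw i).1 hut)] at hexp
  linarith

theorem goodSample_one {κ : ℝ} (hu : AdmissibleWeight u) (hut : u (psiInv u y) ≠ 0) (hn : 0 < n)
    (hS : (scatter x 1).PosDef) (hx : ∀ i, x i ≠ 0) (hex : ∃! w, IsWeightSolution u x w)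
    (hκ : 0 ≤ κ) (hclose : ∀ w, IsWeightSolution u x w → ∀ i, |w i / u (psiInv u y) - 1| ≤ κ)
    (hB : ‖design x‖ ^ 2 ≤ n * B) : GoodSample u y 1 (κ * B) x := by
  have : (0 : ℝ) < n := by exact_mod_cast hn
  refine ⟨existsUnique_isMEstimator hS hx (fun _ => hu.pos) hex, fun S hM => ?_⟩
  obtain ⟨w, hw, rfl⟩ := (isMEstimator_iff hS hx fun _ => hu.pos).mp hM
  have hdiff : (1 / (n * u (psiInv u y))) • scatter x w - sampleCov x =
      scatter x fun i => 1 / n * (w i / u (psiInv u y) - 1) := by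
    simp only [scatter, sampleCov, Finset.smul_sum, ← Finset.sum_sub_distrib, smul_smul, ← sub_smul]
    congr! 2
    field_simp
  rw [whiten_one, hdiff]
  calc _ ≤ 1 / n * κ * ‖design x‖ ^ 2 := opNorm_scatter_le (by positivity) fun i => by
        rw [abs_mul, abs_of_pos (by positivity : 0 < 1 / (n : ℝ))]
        exact mul_le_mul_of_nonneg_left (hclose w hw i) (by positivity)
    _ ≤ 1 / n * κ * (n * B) := by gcongr
    _ = κ * B := by field_simp

theorem IsRegular.mono {ε' : ℝ} (hx : IsRegular x y ε c B) (hε : ε ≤ ε') :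
    IsRegular x y ε' c B :=
  ⟨hx.posDef, fun i => (hx.abs_lev_sub_le i).trans hε, hx.spread, hx.norm_design_sq_le⟩

theorem AdmissibleWeight.exists_goodSample_of_isRegular (hu : AdmissibleWeight u)
    (hy : y ∈ psi u '' Set.Ici 0) (hy₀ : 0 < y) (hc : 0 < c) (hB : 0 < B) :
    ∃ L η : ℝ, 0 < L ∧ 0 < η ∧ ∀ ε, 0 < ε → ε < η → ∃ δ, 0 < δ ∧
      ∀ (n p : ℕ) (x : Fin n → EuclideanSpace ℝ (Fin p)), 0 < n → |(p : ℝ) / n - y| < δ →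
        IsRegular x y ε c B → GoodSample u y 1 (L * ε) x := by
  obtain ⟨η₁, hη₁, hex⟩ := hu.existsUnique_of_isRegular hy hy₀
  obtain ⟨K, η₂, hK, hη₂, hclose⟩ := hu.exists_abs_weight_div_sub_one_le hy hy₀ hc
  refine ⟨K * B, min y (min η₁ η₂), by positivity, by positivity, fun ε hε hεη => ?_⟩
  simp only [lt_min_iff] at hεη
  obtain ⟨hεy, hε₁, hε₂⟩ := hεη
  obtain ⟨δ, hδ, hw⟩ := hclose ε hε hε₂
  refine ⟨δ, hδ, fun n p x hn hp hx => ?_⟩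
  rw [mul_right_comm]
  exact goodSample_one hu (hu.pos (psiInv_pos hy hy₀)).ne' hn hx.posDef (hx.ne_zero hεy)
    (hex n p x c B (hx.mono hε₁.le)) (by positivity) (hw n p x B · hn hp hx)
    hx.norm_design_sq_le

end Regular

section Chernoff

variable {ι : Type*} [Fintype ι] {α : ι → Type*} [∀ i, MeasurableSpace (α i)]

theorem lintegral_exp_sum_pi_le (ν : ∀ i, Measure (α i)) [∀ i, IsProbabilityMeasure (ν i)]
    {f : ∀ i, α i → ℝ} (hf : ∀ i, Measurable (f i)) {K : ι → ℝ}
    (hK : ∀ i, ∫⁻ t, ENNReal.ofReal (Real.exp (f i t)) ∂ν i ≤ ENNReal.ofReal (Real.exp (K i))) :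
    ∫⁻ x, ENNReal.ofReal (Real.exp (∑ i, f i (x i))) ∂Measure.pi ν ≤
      ENNReal.ofReal (Real.exp (∑ i, K i)) := by
  have hm : ∀ i, Measurable fun t => ENNReal.ofReal (Real.exp (f i t)) := fun i =>
    (hf i).exp.ennreal_ofReal
  have hind := iIndepFun_pi (μ := ν) (X := fun i t => ENNReal.ofReal (Real.exp (f i t)))
    fun i => (hm i).aemeasurable
  simp_rw [Real.exp_sum, ENNReal.ofReal_prod_of_nonneg fun _ _ => (Real.exp_pos _).le]
  rw [lintegral_prod_eq_prod_lintegral_of_indepFun Finset.univ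
    (fun i (x : ∀ i, α i) => ENNReal.ofReal (Real.exp (f i (x i)))) hind
    fun i => (hm i).comp (measurable_pi_apply i)]
  exact Finset.prod_le_prod' fun i _ =>
    ((measurePreserving_eval ν i).lintegral_comp (hm i)).trans_le (hK i)

theorem measure_ge_le_exp_sub {β : Type*} [MeasurableSpace β] {μ : Measure β} {f : β → ℝ}
    (hf : Measurable f) {K : ℝ}
    (hK : ∫⁻ x, ENNReal.ofReal (Real.exp (f x)) ∂μ ≤ ENNReal.ofReal (Real.exp K)) (t : ℝ) :
    μ {x | t ≤ f x} ≤ ENNReal.ofReal (Real.exp (K - t)) := by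
  have hexp : {x | t ≤ f x} =
      {x | ENNReal.ofReal (Real.exp t) ≤ ENNReal.ofReal (Real.exp (f x))} := by
    simp_rw [ENNReal.ofReal_le_ofReal_iff (Real.exp_pos _).le, Real.exp_le_exp]
  rw [hexp, Real.exp_sub, ENNReal.ofReal_div_of_pos (Real.exp_pos _)]
  exact (meas_ge_le_lintegral_div hf.exp.ennreal_ofReal.aemeasurable
    (ENNReal.ofReal_pos.mpr (Real.exp_pos t)).ne' ENNReal.ofReal_ne_top).trans
    (ENNReal.div_le_div_right hK _)

theorem pi_measure_ge_le_exp_sub (ν : ∀ i, Measure (α i)) [∀ i, IsProbabilityMeasure (ν i)]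
    {f : ∀ i, α i → ℝ} (hf : ∀ i, Measurable (f i)) {K : ι → ℝ}
    (hK : ∀ i, ∫⁻ t, ENNReal.ofReal (Real.exp (f i t)) ∂ν i ≤ ENNReal.ofReal (Real.exp (K i)))
    (t : ℝ) :
    Measure.pi ν {x | t ≤ ∑ i, f i (x i)} ≤ ENNReal.ofReal (Real.exp (∑ i, K i - t)) :=
  measure_ge_le_exp_sub (Finset.measurable_sum _ fun i _ => (hf i).comp (measurable_pi_apply i))
    (lintegral_exp_sum_pi_le ν hf hK) t

end Chernoff

section GaussianReal

theorem one_le_one_sub_mul_exp {x : ℝ} (hx : x ≤ 1 / 2) :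
    1 ≤ (1 - x) * Real.exp (x + x ^ 2) := by
  have hx' : 0 ≤ 1 - x := by linarith
  rcases le_total x 0 with hneg | hpos
  · refine le_trans ?_ (mul_le_mul_of_nonneg_left (Real.add_one_le_exp (x + x ^ 2)) hx')
    nlinarith [mul_nonneg (neg_nonneg.mpr hneg) (sq_nonneg x)]
  · refine le_trans ?_ (mul_le_mul_of_nonneg_left
      (Real.quadratic_le_exp_of_nonneg (by positivity : 0 ≤ x + x ^ 2)) hx')
    have h : 0 ≤ x ^ 2 * (1 - x - x ^ 2 - x ^ 3) := mul_nonneg (sq_nonneg x) (by nlinarith)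
    nlinarith

theorem gaussianPDFReal_mul_exp_sq (s t : ℝ) :
    gaussianPDFReal 0 1 t * Real.exp (s * t ^ 2) =
      (√(2 * Real.pi))⁻¹ * Real.exp (-(1 / 2 - s) * t ^ 2) := by
  rw [gaussianPDFReal, mul_assoc, ← Real.exp_add]
  simp only [NNReal.coe_one, mul_one, sub_zero]
  congr 2
  ring

theorem lintegral_exp_mul_sq_gaussianReal {s : ℝ} (hs : s < 1 / 2) :
    ∫⁻ t, ENNReal.ofReal (Real.exp (s * t ^ 2)) ∂gaussianReal 0 1 =
      ENNReal.ofReal √((1 - 2 * s)⁻¹) := by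
  have hb : 0 < 1 / 2 - s := by linarith
  rw [gaussianReal_of_var_ne_zero 0 one_ne_zero,
    lintegral_withDensity_eq_lintegral_mul _ (measurable_gaussianPDF 0 1) (by fun_prop)]
  simp only [Pi.mul_apply, gaussianPDF]
  simp_rw [← ENNReal.ofReal_mul (gaussianPDFReal_nonneg _ _ _), gaussianPDFReal_mul_exp_sq]
  rw [← ofReal_integral_eq_lintegral_ofReal ((integrable_exp_neg_mul_sq hb).const_mul _)
    (ae_of_all _ fun t => by positivity), integral_const_mul, integral_gaussian,
    ← Real.sqrt_inv, ← Real.sqrt_mul (by positivity)]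
  congr 2
  have : 1 - 2 * s ≠ 0 := by linarith
  field_simp

theorem lintegral_exp_mul_sq_gaussianReal_le {s : ℝ} (hs : s ≤ 1 / 4) :
    ∫⁻ t, ENNReal.ofReal (Real.exp (s * t ^ 2)) ∂gaussianReal 0 1 ≤
      ENNReal.ofReal (Real.exp (s + 2 * s ^ 2)) := by
  rw [lintegral_exp_mul_sq_gaussianReal (by linarith)]
  refine ENNReal.ofReal_le_ofReal (Real.sqrt_le_iff.mpr ⟨(Real.exp_pos _).le, ?_⟩)
  rw [inv_le_iff_one_le_mul₀' (by linarith), ← Real.exp_nat_mul,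
    show ((2 : ℕ) : ℝ) * (s + 2 * s ^ 2) = 2 * s + (2 * s) ^ 2 by push_cast; ring]
  exact one_le_one_sub_mul_exp (by linarith)

theorem gaussianPDFReal_le_half (t : ℝ) : gaussianPDFReal 0 1 t ≤ 1 / 2 := by
  have hexp : Real.exp (-(t - 0) ^ 2 / (2 * ((1 : NNReal) : ℝ))) ≤ 1 :=
    Real.exp_le_one_iff.mpr
      (div_nonpos_of_nonpos_of_nonneg (neg_nonpos.mpr (sq_nonneg _)) (by positivity))
  have hsqrt : (2 : ℝ) ≤ √(2 * Real.pi * ((1 : NNReal) : ℝ)) := by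
    refine Real.le_sqrt_of_sq_le ?_
    rw [NNReal.coe_one]
    linarith [Real.pi_gt_three]
  calc gaussianPDFReal 0 1 t ≤ (2 : ℝ)⁻¹ * 1 :=
        mul_le_mul (inv_anti₀ two_pos hsqrt) hexp (Real.exp_pos _).le (by norm_num)
    _ = 1 / 2 := by norm_num

theorem gaussianReal_abs_lt_le (c : ℝ) : gaussianReal 0 1 {t | |t| < c} ≤ ENNReal.ofReal c := by
  have hIoo : {t : ℝ | |t| < c} = Set.Ioo (-c) c := by
    ext t
    rw [Set.mem_ofPred_eq, Set.mem_Ioo, abs_lt]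
  rw [gaussianReal_apply 0 one_ne_zero]
  refine (setLIntegral_mono measurable_const fun t _ =>
    ENNReal.ofReal_le_ofReal (gaussianPDFReal_le_half t)).trans_eq ?_
  rw [setLIntegral_const, hIoo, Real.volume_Ioo, ← ENNReal.ofReal_mul (by norm_num)]
  ring_nf

theorem lintegral_exp_indicator_gaussianReal_le {c : ℝ} (hc : 0 ≤ c) :
    ∫⁻ t, ENNReal.ofReal (Real.exp ({t : ℝ | |t| < c}.indicator 1 t)) ∂gaussianReal 0 1 ≤
      ENNReal.ofReal (Real.exp (2 * c)) := by
  have hm : MeasurableSet {t : ℝ | |t| < c} := measurableSet_lt (by fun_prop) measurable_const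
  have hle : ∀ t : ℝ, ENNReal.ofReal (Real.exp ({t : ℝ | |t| < c}.indicator 1 t)) ≤
      1 + {t : ℝ | |t| < c}.indicator (fun _ => ENNReal.ofReal 2) t := fun t => by
    by_cases ht : t ∈ {t : ℝ | |t| < c}
    · rw [Set.indicator_of_mem ht, Set.indicator_of_mem ht, ← ENNReal.ofReal_one,
        ← ENNReal.ofReal_add zero_le_one zero_le_two, Pi.one_apply]
      exact ENNReal.ofReal_le_ofReal (by linarith [Real.exp_one_lt_d9])
    · simp [Set.indicator_of_notMem ht]
  calc _ ≤ ∫⁻ t, (1 + {t : ℝ | |t| < c}.indicator (fun _ => ENNReal.ofReal 2) t)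
        ∂gaussianReal 0 1 := lintegral_mono hle
    _ = ENNReal.ofReal 1 + ENNReal.ofReal 2 * gaussianReal 0 1 {t | |t| < c} := by
        rw [lintegral_add_left measurable_const, lintegral_indicator_const hm]
        simp
    _ ≤ ENNReal.ofReal 1 + ENNReal.ofReal 2 * ENNReal.ofReal c := by
        gcongr
        exact gaussianReal_abs_lt_le c
    _ = ENNReal.ofReal (2 * c + 1) := by
        rw [← ENNReal.ofReal_mul zero_le_two, ← ENNReal.ofReal_add zero_le_one (by positivity),
          add_comm]
    _ ≤ ENNReal.ofReal (Real.exp (2 * c)) := ENNReal.ofReal_le_ofReal (Real.add_one_le_exp _)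

end GaussianReal

section StdGaussian

variable {F : Type*} [NormedAddCommGroup F] [InnerProductSpace ℝ F] [FiniteDimensional ℝ F]
  [MeasurableSpace F] [BorelSpace F]

theorem map_toLp_pi_stdGaussian {ι : Type*} [Fintype ι] :
    (Measure.pi fun _ : ι => stdGaussian F).map (WithLp.toLp 2) =
      stdGaussian (PiLp 2 fun _ : ι => F) := by
  apply Measure.ext_of_charFun
  ext t
  rw [charFun_stdGaussian, charFun_pi]
  simp_rw [charFun_stdGaussian, ← Complex.exp_sum, ← Complex.ofReal_pow, PiLp.norm_sq_eq_of_L2]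
  simp [Finset.sum_div, neg_div]

theorem map_inner_stdGaussian (b : F) :
    (stdGaussian F).map (inner ℝ b) = (gaussianReal 0 1).map fun t => ‖b‖ * t := by
  have h := IsGaussian.map_eq_gaussianReal (μ := stdGaussian F) (innerSL ℝ b)
  rw [integral_strongDual_stdGaussian, variance_dual_stdGaussian, innerSL_apply_norm] at h
  rw [gaussianReal_map_const_mul]
  refine Eq.trans (by rfl) (h.trans ?_)
  congr 1
  · simp
  · ext
    simp

theorem lintegral_exp_inner_sq_stdGaussian_le {s : ℝ} {b : F} (hs : s * ‖b‖ ^ 2 ≤ 1 / 4) :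
    ∫⁻ z, ENNReal.ofReal (Real.exp (s * inner ℝ b z ^ 2)) ∂stdGaussian F ≤
      ENNReal.ofReal (Real.exp (s * ‖b‖ ^ 2 + 2 * (s * ‖b‖ ^ 2) ^ 2)) := by
  have hg : Measurable fun t : ℝ => ENNReal.ofReal (Real.exp (s * t ^ 2)) := by fun_prop
  rw [← lintegral_map hg (by fun_prop : Measurable (inner ℝ b)), map_inner_stdGaussian,
    lintegral_map hg (by fun_prop)]
  simpa only [mul_pow _ _ 2, ← mul_assoc] using lintegral_exp_mul_sq_gaussianReal_le hs

theorem stdGaussian_submodule_eq_zero {U : Submodule ℝ F} (hU : U ≠ ⊤) :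
    stdGaussian F (U : Set F) = 0 := by
  obtain ⟨a, haU, ha⟩ := Submodule.exists_mem_ne_zero_of_ne_bot
    (mt Submodule.orthogonal_eq_bot_iff.mp hU)
  refine measure_mono_null (t := inner ℝ a ⁻¹' {0})
    (fun x hx => Submodule.inner_left_of_mem_orthogonal hx haU) ?_
  have hpre : (fun t : ℝ => ‖a‖ * t) ⁻¹' {0} = {0} := by
    ext t
    simp [ha]
  have := nullSingletonClass_gaussianReal (μ := 0) (v := 1) one_ne_zero
  rw [← Measure.map_apply (by fun_prop) (measurableSet_singleton 0), map_inner_stdGaussian,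
    Measure.map_apply (by fun_prop) (measurableSet_singleton 0), hpre, measure_singleton]

theorem ae_linearIndependent_finCons_stdGaussian {p : ℕ} {c : Fin p → F}
    (hc : LinearIndependent ℝ c) (hp : p < Module.finrank ℝ F) :
    ∀ᵐ v ∂stdGaussian F, LinearIndependent ℝ (Fin.cons v c : Fin (p + 1) → F) := by
  have hne : Submodule.span ℝ (Set.range c) ≠ ⊤ := fun h => by
    have hrank := finrank_span_eq_card hc
    rw [h, finrank_top, Fintype.card_fin] at hrank
    omega
  refine measure_mono_null (fun v hv => ?_) (stdGaussian_submodule_eq_zero hne)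
  by_contra hv'
  exact hv (linearIndependent_finCons.mpr ⟨hc, hv'⟩)

theorem measurableSet_linearIndependent_finCons (p : ℕ) :
    MeasurableSet
      {q : F × (Fin p → F) | LinearIndependent ℝ (Fin.cons q.1 q.2 : Fin (p + 1) → F)} :=
  isOpen_setOfPred_linearIndependent.measurableSet.preimage
    (Continuous.finCons continuous_fst continuous_snd).measurable

theorem ae_linearIndependent_stdGaussian {p : ℕ} (hp : p ≤ Module.finrank ℝ F) :
    ∀ᵐ c ∂(Measure.pi fun _ : Fin p => stdGaussian F), LinearIndependent ℝ c := by
  induction p with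
  | zero => exact ae_of_all _ fun c => linearIndependent_empty_type
  | succ p ih =>
    have hm := measurableSet_linearIndependent_finCons (F := F) p
    have hae : ∀ᵐ q ∂((stdGaussian F).prod (Measure.pi fun _ : Fin p => stdGaussian F)),
        LinearIndependent ℝ (Fin.cons q.1 q.2 : Fin (p + 1) → F) := by
      refine (Measure.ae_prod_iff_ae_ae hm).mpr ((Measure.ae_ae_comm hm).mpr ?_)
      filter_upwards [ih (by omega)] with c hc
      exact ae_linearIndependent_finCons_stdGaussian hc hp
    have hmp := measurePreserving_piFinSuccAbove (fun _ : Fin (p + 1) => stdGaussian F) 0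
    filter_upwards [hmp.quasiMeasurePreserving.ae hae] with c hc
    simpa using hc

theorem measurePreserving_pi_isometry {ι : Type*} [Fintype ι] (f : F ≃ₗᵢ[ℝ] F) :
    MeasurePreserving (fun (c : ι → F) a => f (c a)) (Measure.pi fun _ => stdGaussian F)
      (Measure.pi fun _ => stdGaussian F) :=
  measurePreserving_pi _ _ fun _ => ⟨f.continuous.measurable, stdGaussian_map f⟩

end StdGaussian

section Rows

variable {n p : ℕ}

/-- The rows `x₁, …, xₙ` of the `n × p` matrix with columns `c₁, …, c_p`. -/
def rows (c : Fin p → EuclideanSpace ℝ (Fin n)) : Fin n → EuclideanSpace ℝ (Fin p) :=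
  fun i => WithLp.toLp 2 fun a => c a i

theorem measurable_rows : Measurable (rows (n := n) (p := p)) := by
  unfold rows
  fun_prop

/-- Transposition of matrices, as an isometry for the Frobenius norm. -/
noncomputable def rowsIsometry (n p : ℕ) :
    (PiLp 2 fun _ : Fin p => EuclideanSpace ℝ (Fin n)) ≃ₗᵢ[ℝ]
      (PiLp 2 fun _ : Fin n => EuclideanSpace ℝ (Fin p)) where
  toFun v := WithLp.toLp 2 (rows v.ofLp)
  invFun v := WithLp.toLp 2 (rows v.ofLp)
  map_add' _ _ := rfl
  map_smul' _ _ := rfl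
  left_inv _ := rfl
  right_inv _ := rfl
  norm_map' v := by
    rw [← sq_eq_sq₀ (norm_nonneg _) (norm_nonneg _), PiLp.norm_sq_eq_of_L2, PiLp.norm_sq_eq_of_L2]
    simp only [EuclideanSpace.norm_sq_eq]
    exact Finset.sum_comm

theorem measurePreserving_rows :
    MeasurePreserving (rows (n := n) (p := p))
      (Measure.pi fun _ => stdGaussian (EuclideanSpace ℝ (Fin n)))
      (Measure.pi fun _ => stdGaussian (EuclideanSpace ℝ (Fin p))) := by
  refine ⟨measurable_rows, (MeasurableEquiv.toLp 2 _).map_measurableEquiv_injective ?_⟩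
  rw [MeasurableEquiv.coe_toLp, map_toLp_pi_stdGaussian, Measure.map_map (by fun_prop)
    measurable_rows, ← stdGaussian_map (rowsIsometry n p),
    ← map_toLp_pi_stdGaussian (F := EuclideanSpace ℝ (Fin n)),
    Measure.map_map (rowsIsometry n p).continuous.measurable (by fun_prop)]
  rfl

end Rows

section LowerBound

variable {E F : Type*} [NormedAddCommGroup E] [NormedSpace ℝ E] [NormedAddCommGroup F]
  [NormedSpace ℝ F]

theorem exists_ball_subset_forall_opNorm_div_le (A : E →L[ℝ] F) :
    ∃ v, Metric.ball v (1 / 4) ⊆ Metric.ball 0 1 ∧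
      ∀ b ∈ Metric.ball v (1 / 4), ‖A‖ / 4 ≤ ‖A b‖ := by
  rcases (norm_nonneg A).eq_or_lt with hA | hA
  · refine ⟨0, Metric.ball_subset_ball (by norm_num), fun b _ => ?_⟩
    rw [← hA, zero_div]
    exact norm_nonneg _
  obtain ⟨v, hv, hAv⟩ := A.exists_lt_apply_of_lt_opNorm (r := 2 / 3 * ‖A‖) (by linarith)
  refine ⟨(3 / 4 : ℝ) • v, Metric.ball_subset_ball' ?_, fun b hb => ?_⟩
  · rw [dist_zero_right, norm_smul, Real.norm_of_nonneg (by norm_num)]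
    linarith
  · rw [mem_ball_iff_norm'] at hb
    have hsub := norm_sub_norm_le (A ((3 / 4 : ℝ) • v)) (A b)
    rw [← map_sub, map_smul, norm_smul, Real.norm_of_nonneg (by norm_num)] at hsub
    have hdiff := A.le_opNorm ((3 / 4 : ℝ) • v - b)
    nlinarith

theorem le_setLIntegral_exp_norm_sq [FiniteDimensional ℝ E] [MeasurableSpace E] [BorelSpace E]
    (μ : Measure E) [μ.IsAddHaarMeasure] (A : E →L[ℝ] F) {s : ℝ} (hs : 0 ≤ s) :
    ENNReal.ofReal ((1 / 4) ^ Module.finrank ℝ E * Real.exp (s * (‖A‖ / 4) ^ 2)) *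
      μ (Metric.ball 0 1) ≤
      ∫⁻ b in Metric.ball 0 1, ENNReal.ofReal (Real.exp (s * ‖A b‖ ^ 2)) ∂μ := by
  obtain ⟨v, hball, hv⟩ := exists_ball_subset_forall_opNorm_div_le A
  calc _ = ∫⁻ _b in Metric.ball v (1 / 4), ENNReal.ofReal (Real.exp (s * (‖A‖ / 4) ^ 2)) ∂μ := by
        rw [setLIntegral_const, Measure.addHaar_ball_of_pos μ v (by norm_num),
          ENNReal.ofReal_mul (by positivity), mul_assoc, mul_left_comm]
    _ ≤ ∫⁻ b in Metric.ball v (1 / 4), ENNReal.ofReal (Real.exp (s * ‖A b‖ ^ 2)) ∂μ := by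
        refine setLIntegral_mono' measurableSet_ball fun b hb => ?_
        have := hv b hb
        gcongr
    _ ≤ _ := lintegral_mono_set hball

end LowerBound

section DesignNorm

variable {F ι : Type*} [Fintype ι] [NormedAddCommGroup F] [InnerProductSpace ℝ F]

theorem norm_design_sq (x : ι → F) (b : F) : ‖design x b‖ ^ 2 = ∑ i, inner ℝ b (x i) ^ 2 := by
  simp_rw [EuclideanSpace.real_norm_sq_eq, design_apply, real_inner_comm b]

variable [FiniteDimensional ℝ F]

theorem continuous_design : Continuous (design (F := F) (ι := ι)) := by
  refine LinearMap.continuous_of_finiteDimensional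
    ({ toFun := design, map_add' := fun x x' => ?_, map_smul' := fun r x => ?_ } :
      (ι → F) →ₗ[ℝ] F →L[ℝ] EuclideanSpace ℝ ι)
  · ext b i
    exact inner_add_left _ _ _
  · ext b i
    exact real_inner_smul_left _ _ _

variable [MeasurableSpace F] [BorelSpace F]

theorem lintegral_exp_norm_design_sq_le {b : F} (hb : ‖b‖ ≤ 1) :
    ∫⁻ x, ENNReal.ofReal (Real.exp (1 / 4 * ‖design x b‖ ^ 2))
      ∂(Measure.pi fun _ : ι => stdGaussian F) ≤
      ENNReal.ofReal (Real.exp (3 / 8 * Fintype.card ι)) := by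
  have hb2 : ‖b‖ ^ 2 ≤ 1 := pow_le_one₀ (norm_nonneg _) hb
  have hone : ∫⁻ z, ENNReal.ofReal (Real.exp (1 / 4 * inner ℝ b z ^ 2)) ∂stdGaussian F ≤
      ENNReal.ofReal (Real.exp (3 / 8)) :=
    (lintegral_exp_inner_sq_stdGaussian_le (by linarith)).trans
      (ENNReal.ofReal_le_ofReal (Real.exp_le_exp.mpr (by nlinarith [sq_nonneg ‖b‖])))
  simp_rw [norm_design_sq, Finset.mul_sum]
  refine (lintegral_exp_sum_pi_le (fun _ => stdGaussian F) (fun _ => by fun_prop)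
    fun _ => hone).trans_eq ?_
  rw [Finset.sum_const, Finset.card_univ, nsmul_eq_mul, mul_comm]

-- Instead of a union bound over a net, `exp (‖design x b‖² / 4)` is integrated over the unit ball.
theorem lintegral_pow_mul_exp_norm_design_sq_le :
    ∫⁻ x, ENNReal.ofReal ((1 / 4) ^ Module.finrank ℝ F *
      Real.exp (1 / 4 * (‖design x‖ / 4) ^ 2)) ∂(Measure.pi fun _ : ι => stdGaussian F) ≤
      ENNReal.ofReal (Real.exp (3 / 8 * Fintype.card ι)) := by
  set μ := Measure.pi fun _ : ι => stdGaussian F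
  have hvol0 : volume (Metric.ball (0 : F) 1) ≠ 0 := (Metric.measure_ball_pos _ _ one_pos).ne'
  have hvolt : volume (Metric.ball (0 : F) 1) ≠ ⊤ := measure_ball_lt_top.ne
  have hmeas : Measurable fun q : (ι → F) × F =>
      ENNReal.ofReal (Real.exp (1 / 4 * ‖design q.1 q.2‖ ^ 2)) := by
    simp_rw [norm_design_sq]
    fun_prop
  rw [← ENNReal.mul_le_mul_iff_left hvol0 hvolt, ← lintegral_mul_const' _ _ hvolt]
  calc _ ≤ ∫⁻ x, (∫⁻ b in Metric.ball 0 1,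
        ENNReal.ofReal (Real.exp (1 / 4 * ‖design x b‖ ^ 2))) ∂μ := lintegral_mono fun x =>
        le_setLIntegral_exp_norm_sq volume (design x) (by norm_num)
    _ = ∫⁻ b in Metric.ball 0 1, ∫⁻ x,
        ENNReal.ofReal (Real.exp (1 / 4 * ‖design x b‖ ^ 2)) ∂μ :=
        lintegral_lintegral_swap hmeas.aemeasurable
    _ ≤ ∫⁻ _b in Metric.ball (0 : F) 1, ENNReal.ofReal (Real.exp (3 / 8 * Fintype.card ι)) :=
        setLIntegral_mono measurable_const fun b hb =>
          lintegral_exp_norm_design_sq_le (mem_ball_zero_iff.mp hb).le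
    _ = _ := setLIntegral_const _ _

theorem lintegral_exp_norm_design_sq_div_le :
    ∫⁻ x, ENNReal.ofReal (Real.exp (‖design x‖ ^ 2 / 64))
      ∂(Measure.pi fun _ : ι => stdGaussian F) ≤
      ENNReal.ofReal (Real.exp (3 / 8 * Fintype.card ι + 2 * Module.finrank ℝ F)) := by
  set d := Module.finrank ℝ F
  have hexp2 : (1 : ℝ) ≤ Real.exp (2 * d) * (1 / 4) ^ d := by
    rw [mul_comm 2 (d : ℝ), Real.exp_nat_mul, ← mul_pow]
    exact one_le_pow₀ (by linarith [Real.quadratic_le_exp_of_nonneg zero_le_two])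
  calc _ ≤ ∫⁻ x, ENNReal.ofReal (Real.exp (2 * d)) *
        ENNReal.ofReal ((1 / 4) ^ d * Real.exp (1 / 4 * (‖design x‖ / 4) ^ 2))
        ∂(Measure.pi fun _ : ι => stdGaussian F) := by
        refine lintegral_mono fun x => ?_
        rw [← ENNReal.ofReal_mul (Real.exp_pos _).le, ← mul_assoc,
          show 1 / 4 * (‖design x‖ / 4) ^ 2 = ‖design x‖ ^ 2 / 64 by ring]
        exact ENNReal.ofReal_le_ofReal (le_mul_of_one_le_left (Real.exp_pos _).le hexp2)
    _ ≤ ENNReal.ofReal (Real.exp (2 * d)) *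
        ENNReal.ofReal (Real.exp (3 / 8 * Fintype.card ι)) := by
        rw [lintegral_const_mul' _ _ ENNReal.ofReal_ne_top]
        gcongr
        exact lintegral_pow_mul_exp_norm_design_sq_le
    _ = _ := by
        rw [← ENNReal.ofReal_mul (Real.exp_pos _).le, ← Real.exp_add, add_comm]

theorem measure_norm_design_sq_ge_le (hF : Module.finrank ℝ F ≤ Fintype.card ι) :
    (Measure.pi fun _ : ι => stdGaussian F) {x | Fintype.card ι * 256 ≤ ‖design x‖ ^ 2} ≤
      ENNReal.ofReal (Real.exp (-Fintype.card ι)) := by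
  have hF' : (Module.finrank ℝ F : ℝ) ≤ Fintype.card ι := by exact_mod_cast hF
  have hm : Measurable fun x : ι → F => ‖design x‖ ^ 2 / 64 :=
    ((continuous_design.norm.pow 2).div_const 64).measurable
  refine (measure_mono fun x hx => ?_).trans
    ((measure_ge_le_exp_sub hm lintegral_exp_norm_design_sq_div_le (4 * Fintype.card ι)).trans
      (ENNReal.ofReal_le_ofReal (Real.exp_le_exp.mpr (by linarith))))
  rw [Set.mem_ofPred_eq] at hx ⊢
  linarith

end DesignNorm

section ChiSquare

theorem pi_gaussianReal_nonneg_sum_mul_sq_le {ι : Type*} [Fintype ι] {ε : ℝ} (hε : 0 < ε)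
    (hε1 : ε ≤ 1) {κ : ι → ℝ} (hκ : ∀ i, |κ i| ≤ 2) (hsum : ∑ i, κ i ≤ -(Fintype.card ι * ε)) :
    (Measure.pi fun _ : ι => gaussianReal 0 1) {x | 0 ≤ ∑ i, κ i * x i ^ 2} ≤
      ENNReal.ofReal (Real.exp (-(Fintype.card ι * ε ^ 2 / 32))) := by
  have hscale : ∀ i, ε / 16 * κ i ≤ 1 / 4 := fun i => by nlinarith [(abs_le.mp (hκ i)).2]
  have hset : {x : ι → ℝ | 0 ≤ ∑ i, κ i * x i ^ 2} =
      {x | 0 ≤ ∑ i, ε / 16 * κ i * x i ^ 2} := by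
    ext x
    simp_rw [Set.mem_ofPred_eq, mul_assoc (ε / 16), ← Finset.mul_sum]
    exact (mul_nonneg_iff_of_pos_left (by positivity)).symm
  rw [hset]
  refine (pi_measure_ge_le_exp_sub (fun _ => gaussianReal 0 1) (fun _ => by fun_prop)
    (fun i => lintegral_exp_mul_sq_gaussianReal_le (hscale i)) 0).trans
    (ENNReal.ofReal_le_ofReal (Real.exp_le_exp.mpr ?_))
  have hsq : ∑ i, 2 * (ε / 16 * κ i) ^ 2 ≤ ∑ _i : ι, ε ^ 2 / 32 :=
    Finset.sum_le_sum fun i _ => by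
      have hκ2 : κ i ^ 2 ≤ 2 ^ 2 := sq_le_sq' (abs_le.mp (hκ i)).1 (abs_le.mp (hκ i)).2
      nlinarith [mul_nonneg (sq_nonneg ε) (sub_nonneg.mpr hκ2)]
  rw [Finset.sum_const, Finset.card_univ, nsmul_eq_mul] at hsq
  rw [sub_zero, Finset.sum_add_distrib, ← Finset.mul_sum]
  linarith [mul_le_mul_of_nonneg_left hsum (by positivity : 0 ≤ ε / 16)]

variable {F : Type*} [NormedAddCommGroup F] [InnerProductSpace ℝ F] [FiniteDimensional ℝ F]

theorem norm_sq_sum_smul_orthonormalBasis {E ι : Type*} [Fintype ι] [NormedAddCommGroup E]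
    [InnerProductSpace ℝ E] (b : OrthonormalBasis ι ℝ E) (x : ι → ℝ) :
    ‖∑ i, x i • b i‖ ^ 2 = ∑ i, x i ^ 2 := by
  rw [← EuclideanSpace.real_norm_sq_eq (WithLp.toLp 2 x), ← b.repr.symm.norm_map,
    ← b.sum_repr_symm]

theorem exists_orthonormalBasis_norm_sq_starProjection (K : Submodule ℝ F) :
    ∃ b : OrthonormalBasis (Fin (Module.finrank ℝ K) ⊕ Fin (Module.finrank ℝ Kᗮ)) ℝ F,
      ∀ x : _ → ℝ, ‖K.starProjection (∑ i, x i • b i)‖ ^ 2 = ∑ i, x (Sum.inl i) ^ 2 ∧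
        ‖Kᗮ.starProjection (∑ i, x i • b i)‖ ^ 2 = ∑ i, x (Sum.inr i) ^ 2 := by
  set v := stdOrthonormalBasis ℝ K
  set w := stdOrthonormalBasis ℝ Kᗮ
  set b := (v.prod w).map K.orthogonalDecomposition.symm with hb
  have hinl : ∀ i, b (Sum.inl i) = v i := fun i => by simp [hb]
  have hinr : ∀ i, b (Sum.inr i) = w i := fun i => by simp [hb]
  have hK : ∀ i, K.starProjection (w i : F) = 0 := fun i =>
    K.starProjection_apply_eq_zero_iff.mpr (w i).2
  refine ⟨b, fun x => ?_⟩
  have hKv : K.starProjection (∑ i, x i • b i) = (∑ i, x (Sum.inl i) • v i : K) := by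
    simp [hinl, hinr, hK]
  have hKw : Kᗮ.starProjection (∑ i, x i • b i) = (∑ i, x (Sum.inr i) • w i : Kᗮ) := by
    simp [hinl, hinr, hK]
  rw [hKv, hKw, ← Submodule.coe_norm, ← Submodule.coe_norm]
  exact ⟨norm_sq_sum_smul_orthonormalBasis v _, norm_sq_sum_smul_orthonormalBasis w _⟩

variable [MeasurableSpace F] [BorelSpace F]

theorem stdGaussian_nonneg_norm_sq_starProjection_le (K : Submodule ℝ F) {ε α β : ℝ} (hε : 0 < ε)
    (hε1 : ε ≤ 1) (hα : |α| ≤ 2) (hβ : |β| ≤ 2)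
    (hαβ : α * Module.finrank ℝ K + β * Module.finrank ℝ Kᗮ ≤ -(Module.finrank ℝ F * ε)) :
    stdGaussian F {g | 0 ≤ α * ‖K.starProjection g‖ ^ 2 + β * ‖Kᗮ.starProjection g‖ ^ 2} ≤
      ENNReal.ofReal (Real.exp (-(Module.finrank ℝ F * ε ^ 2 / 32))) := by
  obtain ⟨b, hb⟩ := exists_orthonormalBasis_norm_sq_starProjection K
  have hm : MeasurableSet
      {g | 0 ≤ α * ‖K.starProjection g‖ ^ 2 + β * ‖Kᗮ.starProjection g‖ ^ 2} :=
    measurableSet_le (by fun_prop) (by fun_prop)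
  have hset : (fun x : Fin (Module.finrank ℝ K) ⊕ Fin (Module.finrank ℝ Kᗮ) → ℝ =>
      ∑ i, x i • b i) ⁻¹'
      {g | 0 ≤ α * ‖K.starProjection g‖ ^ 2 + β * ‖Kᗮ.starProjection g‖ ^ 2} =
      {x | 0 ≤ ∑ i, Sum.elim (fun _ => α) (fun _ => β) i * x i ^ 2} := by
    ext x
    rw [Set.mem_preimage, Set.mem_ofPred_eq, (hb x).1, (hb x).2, Set.mem_ofPred_eq,
      Fintype.sum_sum_type, Finset.mul_sum, Finset.mul_sum]
    rfl
  rw [Module.finrank_eq_card_basis b.toBasis] at hαβ ⊢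
  rw [stdGaussian_eq_map_pi_orthonormalBasis b, Measure.map_apply (by fun_prop) hm, hset]
  refine pi_gaussianReal_nonneg_sum_mul_sq_le hε hε1 (by simp [hα, hβ]) (le_of_eq_of_le ?_ hαβ)
  simp [Fintype.sum_sum_type, mul_comm]

theorem stdGaussian_abs_norm_sq_starProjection_sub_ge_le (K : Submodule ℝ F) {ε : ℝ} (hε : 0 < ε)
    (hε1 : ε ≤ 1) :
    stdGaussian F {g | ε * ‖g‖ ^ 2 ≤
      |‖K.starProjection g‖ ^ 2 - Module.finrank ℝ K / Module.finrank ℝ F * ‖g‖ ^ 2|} ≤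
      ENNReal.ofReal (2 * Real.exp (-(Module.finrank ℝ F * ε ^ 2 / 32))) := by
  set r : ℝ := Module.finrank ℝ K / Module.finrank ℝ F with hr
  have hr₀ : 0 ≤ r := by positivity
  have hr₁ : r ≤ 1 := div_le_one_of_le₀ (by exact_mod_cast K.finrank_le) (by positivity)
  have hK : (Module.finrank ℝ K : ℝ) = r * Module.finrank ℝ F := by
    rcases Nat.eq_zero_or_pos (Module.finrank ℝ F) with hF | hF
    · simpa [hF] using K.finrank_le
    · rw [hr, div_mul_cancel₀ _ (by positivity)]
  have hKo : (Module.finrank ℝ K : ℝ) + Module.finrank ℝ Kᗮ = Module.finrank ℝ F := by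
    exact_mod_cast K.finrank_add_finrank_orthogonal
  have hsub : {g : F | ε * ‖g‖ ^ 2 ≤ |‖K.starProjection g‖ ^ 2 - r * ‖g‖ ^ 2|} ⊆
      {g | 0 ≤ (1 - r - ε) * ‖K.starProjection g‖ ^ 2 + (-r - ε) * ‖Kᗮ.starProjection g‖ ^ 2} ∪
      {g | 0 ≤ (r - ε - 1) * ‖K.starProjection g‖ ^ 2 +
        (r - ε) * ‖Kᗮ.starProjection g‖ ^ 2} := fun g hg => by
    rw [Set.mem_ofPred_eq, Submodule.norm_sq_eq_add_norm_sq_starProjection g K] at hg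
    rcases le_abs.mp hg with h | h
    · exact Or.inl (by rw [Set.mem_ofPred_eq]; linarith)
    · exact Or.inr (by rw [Set.mem_ofPred_eq]; linarith)
  refine (measure_mono hsub).trans ((measure_union_le _ _).trans ?_)
  rw [two_mul, ENNReal.ofReal_add (Real.exp_pos _).le (Real.exp_pos _).le]
  refine add_le_add
    (stdGaussian_nonneg_norm_sq_starProjection_le K hε hε1 (abs_le.mpr ⟨?_, ?_⟩)
      (abs_le.mpr ⟨?_, ?_⟩) ?_)
    (stdGaussian_nonneg_norm_sq_starProjection_le K hε hε1 (abs_le.mpr ⟨?_, ?_⟩)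
      (abs_le.mpr ⟨?_, ?_⟩) ?_) <;> nlinarith

end ChiSquare

section GramProj

variable {ι F : Type*} [Fintype ι] [DecidableEq ι] [NormedAddCommGroup F] [InnerProductSpace ℝ F]

open Matrix

/-- The vector `∑ₐ ((gram c)⁻¹ (⟪c_b, v⟫)_b)ₐ cₐ`, which for linearly independent `c` is the
orthogonal projection of `v` onto the span of `c`. This formula makes measurability in `c` plain. -/
noncomputable def gramProj (c : ι → F) (v : F) : F :=
  ∑ a, ((gram ℝ c)⁻¹ *ᵥ fun b => inner ℝ (c b) v) a • c a

theorem gramProj_smul (c : ι → F) (r : ℝ) (v : F) : gramProj c (r • v) = r • gramProj c v := by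
  have hinner : (fun b => inner ℝ (c b) (r • v)) = r • fun b => inner ℝ (c b) v :=
    funext fun b => real_inner_smul_right _ _ _
  simp only [gramProj, hinner, mulVec_smul, Pi.smul_apply, smul_assoc, Finset.smul_sum]

theorem gramProj_map (f : F ≃ₗᵢ[ℝ] F) (c : ι → F) (v : F) :
    gramProj (fun a => f (c a)) (f v) = f (gramProj c v) := by
  have hgram : gram ℝ (fun a => f (c a)) = gram ℝ c := by
    ext a b
    simp only [gram_apply, f.inner_map_map]
  simp only [gramProj, hgram, f.inner_map_map, map_sum, map_smul]

theorem gramProj_eq_starProjection {c : ι → F} (hc : LinearIndependent ℝ c) (v : F)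
    [(Submodule.span ℝ (Set.range c)).HasOrthogonalProjection] :
    gramProj c v = (Submodule.span ℝ (Set.range c)).starProjection v := by
  refine (Submodule.eq_starProjection_of_mem_of_inner_eq_zero
    (Submodule.sum_mem _ fun a _ =>
      Submodule.smul_mem _ _ (Submodule.subset_span (Set.mem_range_self a)))
    fun w hw => ?_).symm
  have hdet : IsUnit (gram ℝ c).det := (det_gram_ne_zero_iff_linearIndependent.mpr hc).isUnit
  induction hw using Submodule.span_induction with
  | zero => exact inner_zero_right _
  | add w₁ w₂ _ _ h₁ h₂ => rw [inner_add_right, h₁, h₂, add_zero]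
  | smul r w _ h => rw [real_inner_smul_right, h, mul_zero]
  | mem w hw =>
    obtain ⟨b, rfl⟩ := hw
    have hb := congrFun (congrArg (· *ᵥ fun a => inner ℝ (c a) v) (mul_nonsing_inv _ hdet)) b
    simp only [← mulVec_mulVec, one_mulVec] at hb
    rw [real_inner_comm, inner_sub_right, ← hb, sub_eq_zero]
    rw [inner_sum, mulVec, dotProduct]
    exact Finset.sum_congr rfl fun a _ => by rw [real_inner_smul_right, mul_comm]; rfl

theorem measurable_matrix_inv {α : Type*} [MeasurableSpace α] {M : α → Matrix ι ι ℝ}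
    (hM : ∀ a b, Measurable fun x => M x a b) (a b : ι) : Measurable fun x => (M x)⁻¹ a b := by
  have hdet : ∀ N : α → Matrix ι ι ℝ, (∀ a b, Measurable fun x => N x a b) →
      Measurable fun x => (N x).det := fun N hN => by
    simp_rw [det_apply]
    fun_prop
  simp_rw [inv_def, Matrix.smul_apply, Ring.inverse_eq_inv', smul_eq_mul, adjugate_apply]
  refine (hdet M hM).inv.mul (hdet _ fun i j => ?_)
  simp_rw [updateRow_apply]
  split_ifs
  · exact measurable_const
  · exact hM _ _

variable [FiniteDimensional ℝ F] [MeasurableSpace F] [BorelSpace F]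

theorem measurable_gramProj : Measurable fun q : (ι → F) × F => gramProj q.1 q.2 := by
  have hinv : ∀ a b, Measurable fun q : (ι → F) × F => (gram ℝ q.1)⁻¹ a b :=
    measurable_matrix_inv fun a b => by
      simp_rw [gram_apply]
      fun_prop
  simp only [gramProj, mulVec, dotProduct]
  refine Finset.measurable_sum _ fun a _ => Measurable.smul ?_ (by fun_prop)
  exact Finset.measurable_sum _ fun b _ => (hinv a b).mul (by fun_prop)

theorem measurable_gramProj_left (v : F) : Measurable fun c : ι → F => gramProj c v := by
  have h := (measurable_gramProj (ι := ι) (F := F)).comp (measurable_prodMk_right (y := v))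
  simpa only [Function.comp_def] using h

end GramProj

section Leverage

variable {F : Type*} [NormedAddCommGroup F] [InnerProductSpace ℝ F] [FiniteDimensional ℝ F]
  [MeasurableSpace F] [BorelSpace F] {p : ℕ} {ε : ℝ}

theorem stdGaussian_abs_norm_sq_gramProj_sub_ge_le (hε : 0 < ε) (hε1 : ε ≤ 1) {c : Fin p → F}
    (hc : LinearIndependent ℝ c) :
    stdGaussian F
      {g | ε * ‖g‖ ^ 2 ≤ |‖gramProj c g‖ ^ 2 - p / Module.finrank ℝ F * ‖g‖ ^ 2|} ≤
      ENNReal.ofReal (2 * Real.exp (-(Module.finrank ℝ F * ε ^ 2 / 32))) := by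
  have h := stdGaussian_abs_norm_sq_starProjection_sub_ge_le (Submodule.span ℝ (Set.range c)) hε hε1
  rw [finrank_span_eq_card hc, Fintype.card_fin] at h
  simpa only [gramProj_eq_starProjection hc] using h

-- By rotation invariance, the law of `‖gramProj c e‖²` is that of `‖gramProj c g‖² / ‖g‖²` for an
-- independent Gaussian vector `g`.
theorem pi_stdGaussian_le_stdGaussian_gramProj (r : ℝ) {e : F} (he : ‖e‖ = 1) (g : F) :
    (Measure.pi fun _ : Fin p => stdGaussian F) {c | ε ≤ |‖gramProj c e‖ ^ 2 - r|} ≤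
      (Measure.pi fun _ : Fin p => stdGaussian F)
        {c | ε * ‖g‖ ^ 2 ≤ |‖gramProj c g‖ ^ 2 - r * ‖g‖ ^ 2|} := by
  have hm : MeasurableSet {c : Fin p → F | ε ≤ |‖gramProj c e‖ ^ 2 - r|} :=
    measurableSet_le measurable_const
      (((measurable_gramProj_left e).norm.pow_const 2).sub_const r).norm
  obtain ⟨f, hf⟩ : ∃ f : F ≃ₗᵢ[ℝ] F, f g = ‖g‖ • e :=
    ⟨_, Submodule.reflection_sub (by rw [norm_smul, he, norm_norm, mul_one])⟩
  rw [← (measurePreserving_pi_isometry f).measure_preimage hm.nullMeasurableSet]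
  refine measure_mono fun c hc => ?_
  rw [Set.mem_preimage, Set.mem_ofPred_eq] at hc
  have hnorm : ‖gramProj c g‖ = ‖g‖ * ‖gramProj (fun a => f (c a)) e‖ := by
    rw [← f.norm_map, ← gramProj_map, hf, gramProj_smul, norm_smul, norm_norm]
  rw [Set.mem_ofPred_eq, hnorm, mul_pow, mul_comm r, ← mul_sub, abs_mul,
    abs_of_nonneg (sq_nonneg _), mul_comm]
  gcongr

theorem pi_stdGaussian_abs_norm_sq_gramProj_sub_ge_le (hp : p ≤ Module.finrank ℝ F) (hε : 0 < ε)
    (hε1 : ε ≤ 1) {e : F} (he : ‖e‖ = 1) :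
    (Measure.pi fun _ : Fin p => stdGaussian F)
      {c | ε ≤ |‖gramProj c e‖ ^ 2 - p / Module.finrank ℝ F|} ≤
      ENNReal.ofReal (2 * Real.exp (-(Module.finrank ℝ F * ε ^ 2 / 32))) := by
  set μ := Measure.pi fun _ : Fin p => stdGaussian F
  set r : ℝ := p / Module.finrank ℝ F
  let A : Set ((Fin p → F) × F) := {q | ε * ‖q.2‖ ^ 2 ≤ |‖gramProj q.1 q.2‖ ^ 2 - r * ‖q.2‖ ^ 2|}
  have hA : MeasurableSet A :=
    measurableSet_le (by fun_prop) ((measurable_gramProj.norm.pow_const 2).sub (by fun_prop)).norm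
  calc μ {c | ε ≤ |‖gramProj c e‖ ^ 2 - r|}
      = ∫⁻ _g, μ {c | ε ≤ |‖gramProj c e‖ ^ 2 - r|} ∂stdGaussian F := by simp
    _ ≤ ∫⁻ g, μ {c | (c, g) ∈ A} ∂stdGaussian F :=
        lintegral_mono (pi_stdGaussian_le_stdGaussian_gramProj r he)
    _ = (μ.prod (stdGaussian F)) A := (Measure.prod_apply_symm hA).symm
    _ = ∫⁻ c, stdGaussian F {g | (c, g) ∈ A} ∂μ := Measure.prod_apply hA
    _ ≤ ∫⁻ _c, ENNReal.ofReal (2 * Real.exp (-(Module.finrank ℝ F * ε ^ 2 / 32))) ∂μ := by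
        refine lintegral_mono_ae ?_
        filter_upwards [ae_linearIndependent_stdGaussian hp] with c hc
        exact stdGaussian_abs_norm_sq_gramProj_sub_ge_le hε hε1 hc
    _ = _ := by simp

end Leverage

section Direction

variable {F : Type*} [NormedAddCommGroup F] [InnerProductSpace ℝ F] {U : Submodule ℝ F}

theorem exists_isometry_apply_eq {v w : F} (hv : v ∈ U) (hw : w ∈ U) (h : ‖v‖ = ‖w‖) :
    ∃ f : F ≃ₗᵢ[ℝ] F, (∀ z ∈ Uᗮ, f z = z) ∧ f v = w :=
  ⟨_, fun _ hz => Submodule.reflection_mem_subspace_eq_self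
      (Submodule.mem_orthogonal_singleton_iff_inner_right.mpr (hz _ (U.sub_mem hv hw))),
    Submodule.reflection_sub h⟩

theorem starProjection_map_of_forall_mem_orthogonal [U.HasOrthogonalProjection] (f : F ≃ₗᵢ[ℝ] F)
    (hf : ∀ z ∈ Uᗮ, f z = z) (v : F) :
    U.starProjection (f v) = f (U.starProjection v) := by
  refine Submodule.eq_starProjection_of_mem_of_inner_eq_zero ?_ fun w hw => ?_
  · refine U.orthogonal_orthogonal.le fun z hz => ?_
    rw [← hf z hz, f.inner_map_map]
    exact U.inner_left_of_mem_orthogonal (U.starProjection_apply_mem v) hz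
  · have hmem : v - U.starProjection v ∈ Uᗮ := U.sub_starProjection_mem_orthogonal v
    rw [← map_sub, hf _ hmem]
    exact U.inner_left_of_mem_orthogonal hw hmem

variable [MeasurableSpace F]

/-- A measure is rotation invariant on `U` if it is preserved by the linear isometries that fix
`Uᗮ` pointwise. -/
def IsRotationInvariantOn (U : Submodule ℝ F) (ρ : Measure F) : Prop :=
  ∀ f : F ≃ₗᵢ[ℝ] F, (∀ z ∈ Uᗮ, f z = z) → ρ.map f = ρ

/-- The law of the direction of the orthogonal projection of `v` onto `U`, for `v` of law `ρ`. The
event that the projection is `0` is left out, so the total mass may be less than that of `ρ`. -/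
noncomputable def directionLaw (U : Submodule ℝ F) [U.HasOrthogonalProjection] (ρ : Measure F) :
    Measure F :=
  (ρ.restrict {v | U.starProjection v ≠ 0}).map fun v =>
    ‖U.starProjection v‖⁻¹ • U.starProjection v

variable {σ ρ : Measure F}

theorem charFun_map_isometry [BorelSpace F] (f : F ≃ₗᵢ[ℝ] F) (ξ : F) :
    charFun (σ.map f) (f ξ) = charFun σ ξ := by
  rw [charFun_apply, charFun_apply,
    integral_map f.continuous.aemeasurable (by fun_prop)]
  simp_rw [f.inner_map_map]

theorem charFun_starProjection [U.HasOrthogonalProjection] (hσ : ∀ᵐ θ ∂σ, θ ∈ U) (ξ : F) :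
    charFun σ (U.starProjection ξ) = charFun σ ξ := by
  rw [charFun_apply, charFun_apply]
  refine integral_congr_ae ?_
  filter_upwards [hσ] with θ hθ
  rw [← U.inner_starProjection_left_eq_right, U.starProjection_eq_self_iff.mpr hθ]

theorem IsRotationInvariantOn.charFun_eq [BorelSpace F] [U.HasOrthogonalProjection]
    (hσ : IsRotationInvariantOn U σ) (hU : ∀ᵐ θ ∂σ, θ ∈ U) {ξ ξ' : F}
    (h : ‖U.starProjection ξ‖ = ‖U.starProjection ξ'‖) : charFun σ ξ = charFun σ ξ' := by
  obtain ⟨f, hf, hξ⟩ := exists_isometry_apply_eq (U.starProjection_apply_mem ξ)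
    (U.starProjection_apply_mem ξ') h
  rw [← charFun_starProjection hU ξ, ← charFun_starProjection hU ξ', ← hξ]
  nth_rw 2 [← hσ f hf]
  rw [charFun_map_isometry]

variable [BorelSpace F] [FiniteDimensional ℝ F]

theorem integral_charFun_smul_comm (σ₁ σ₂ : Measure F) [IsFiniteMeasure σ₁] [IsFiniteMeasure σ₂]
    (r : ℝ) : ∫ θ, charFun σ₁ (r • θ) ∂σ₂ = ∫ θ, charFun σ₂ (r • θ) ∂σ₁ := by
  have hint : Integrable (Function.uncurry fun θ' θ : F =>
      Complex.exp (inner ℝ θ (r • θ') * Complex.I)) (σ₂.prod σ₁) := by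
    refine Integrable.of_bound (C := 1) (Continuous.aestronglyMeasurable ?_)
      (ae_of_all _ fun q => (Complex.norm_exp_ofReal_mul_I _).le)
    simp only [Function.uncurry_def]
    fun_prop
  simp_rw [charFun_apply]
  rw [integral_integral_swap hint]
  simp_rw [real_inner_smul_right, real_inner_comm]

theorem IsRotationInvariantOn.integral_charFun_smul {σ₁ σ₂ : Measure F} [IsFiniteMeasure σ₂]
    (hσ₁ : IsRotationInvariantOn U σ₁) (h₁ : ∀ᵐ θ ∂σ₁, θ ∈ U)
    (h₂ : ∀ᵐ θ ∂σ₂, θ ∈ U ∧ ‖θ‖ = 1) (ξ : F) :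
    ∫ θ, charFun σ₁ (‖U.starProjection ξ‖ • θ) ∂σ₂ = σ₂.real Set.univ • charFun σ₁ ξ := by
  rw [← integral_const]
  refine integral_congr_ae ?_
  filter_upwards [h₂] with θ hθ
  refine hσ₁.charFun_eq h₁ ?_
  rw [map_smul, U.starProjection_eq_self_iff.mpr hθ.1, norm_smul, norm_norm, hθ.2, mul_one]

theorem IsRotationInvariantOn.smul_eq_smul {σ₁ σ₂ : Measure F} [IsFiniteMeasure σ₁]
    [IsFiniteMeasure σ₂] (hσ₁ : IsRotationInvariantOn U σ₁) (hσ₂ : IsRotationInvariantOn U σ₂)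
    (h₁ : ∀ᵐ θ ∂σ₁, θ ∈ U ∧ ‖θ‖ = 1) (h₂ : ∀ᵐ θ ∂σ₂, θ ∈ U ∧ ‖θ‖ = 1) :
    σ₂ Set.univ • σ₁ = σ₁ Set.univ • σ₂ := by
  have := σ₁.smul_finite (measure_ne_top σ₂ Set.univ)
  have := σ₂.smul_finite (measure_ne_top σ₁ Set.univ)
  refine Measure.ext_of_charFun (funext fun ξ => ?_)
  simp_rw [charFun_apply, integral_smul_measure, ← charFun_apply]
  exact (hσ₁.integral_charFun_smul (h₁.mono fun _ h => h.1) h₂ ξ).symm.trans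
    ((integral_charFun_smul_comm σ₁ σ₂ _).trans
      (hσ₂.integral_charFun_smul (h₂.mono fun _ h => h.1) h₁ ξ))

theorem directionLaw_apply {B : Set F} (hB : MeasurableSet B) :
    directionLaw U ρ B =
      ρ {v | U.starProjection v ≠ 0 ∧ ‖U.starProjection v‖⁻¹ • U.starProjection v ∈ B} := by
  have hm : Measurable fun v => ‖U.starProjection v‖⁻¹ • U.starProjection v := by fun_prop
  rw [directionLaw, Measure.map_apply hm hB, Measure.restrict_apply (hm hB), Set.inter_comm]
  rfl

theorem ae_directionLaw : ∀ᵐ θ ∂directionLaw U ρ, θ ∈ U ∧ ‖θ‖ = 1 := by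
  have hne : MeasurableSet {v | U.starProjection v ≠ 0} :=
    (measurableSet_eq_fun (by fun_prop) measurable_const).compl
  have hm : MeasurableSet {θ : F | θ ∈ U ∧ ‖θ‖ = 1} :=
    U.closed_of_finiteDimensional.measurableSet.inter
      (measurableSet_eq_fun measurable_norm measurable_const)
  rw [directionLaw, ae_map_iff (by fun_prop) hm, ae_restrict_iff' hne]
  refine ae_of_all _ fun v hv => ⟨U.smul_mem _ (U.starProjection_apply_mem v), ?_⟩
  rw [norm_smul, norm_inv, norm_norm, inv_mul_cancel₀ (norm_ne_zero_iff.mpr hv)]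

theorem isRotationInvariantOn_directionLaw (hρ : IsRotationInvariantOn U ρ) :
    IsRotationInvariantOn U (directionLaw U ρ) := by
  refine fun f hf => Measure.ext fun B hB => ?_
  have hm : MeasurableSet {v | U.starProjection v ≠ 0 ∧
      ‖U.starProjection v‖⁻¹ • U.starProjection v ∈ B} :=
    (measurableSet_eq_fun (by fun_prop) measurable_const).compl.inter
      (measurableSet_preimage (by fun_prop) hB)
  rw [Measure.map_apply f.continuous.measurable hB, directionLaw_apply hB,
    directionLaw_apply (f.continuous.measurable hB)]
  conv_rhs => rw [← hρ f hf, Measure.map_apply f.continuous.measurable hm]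
  congr 1
  ext v
  simp [starProjection_map_of_forall_mem_orthogonal f hf]

theorem IsRotationInvariantOn.measure_starProjection_mem_le {ρ' : Measure F}
    [IsProbabilityMeasure ρ] [IsProbabilityMeasure ρ'] (hρ : IsRotationInvariantOn U ρ)
    (hρ' : IsRotationInvariantOn U ρ') (hne : ∀ᵐ v ∂ρ', U.starProjection v ≠ 0) {B : Set F}
    (hB : MeasurableSet B) (hcone : ∀ r : ℝ, 0 < r → ∀ z, r • z ∈ B ↔ z ∈ B) :
    ρ {v | U.starProjection v ≠ 0 ∧ U.starProjection v ∈ B} ≤ ρ' {v | U.starProjection v ∈ B} := by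
  have hfinite : ∀ ρ : Measure F, [IsProbabilityMeasure ρ] → IsFiniteMeasure (directionLaw U ρ) :=
    fun ρ _ => by unfold directionLaw; infer_instance
  have := hfinite ρ
  have := hfinite ρ'
  have hdir : ∀ ρ : Measure F, directionLaw U ρ B =
      ρ {v | U.starProjection v ≠ 0 ∧ U.starProjection v ∈ B} := fun ρ => by
    rw [directionLaw_apply hB]
    congr 1
    ext v
    exact and_congr_right fun hv => hcone _ (inv_pos.mpr (norm_pos_iff.mpr hv)) _
  have huniv : ∀ ρ : Measure F, directionLaw U ρ Set.univ = ρ {v | U.starProjection v ≠ 0} :=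
    fun ρ => by simp [directionLaw_apply MeasurableSet.univ]
  have hone : ρ' {v | U.starProjection v ≠ 0} = 1 := (prob_compl_eq_zero_iff
    (measurableSet_eq_fun (by fun_prop) measurable_const).compl).mp hne
  have h := congrArg (· B) ((isRotationInvariantOn_directionLaw hρ).smul_eq_smul
    (isRotationInvariantOn_directionLaw hρ') ae_directionLaw ae_directionLaw)
  simp only [Measure.smul_apply, smul_eq_mul, hdir, huniv, hone, one_mul] at h
  rw [h]
  exact (mul_le_of_le_one_left' prob_le_one).trans (measure_mono fun v hv => hv.2)

end Direction

section GramProjLaw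

variable {F : Type*} [NormedAddCommGroup F] [InnerProductSpace ℝ F]

theorem inner_gramProj_self {ι : Type*} [Fintype ι] [DecidableEq ι] {c : ι → F}
    (hc : LinearIndependent ℝ c) (v : F) : inner ℝ v (gramProj c v) = ‖gramProj c v‖ ^ 2 := by
  have := FiniteDimensional.span_of_finite ℝ (Set.finite_range c)
  set K := Submodule.span ℝ (Set.range c)
  rw [gramProj_eq_starProjection hc, ← real_inner_self_eq_norm_sq,
    K.inner_starProjection_left_eq_right,
    K.starProjection_eq_self_iff.mpr (K.starProjection_apply_mem v)]

theorem norm_sq_starProjection_gramProj {ι : Type*} [Fintype ι] [DecidableEq ι] {c : ι → F}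
    (hc : LinearIndependent ℝ c) {e : F} (he : ‖e‖ = 1) :
    ‖(ℝ ∙ e)ᗮ.starProjection (gramProj c e)‖ ^ 2 =
      ‖gramProj c e‖ ^ 2 - (‖gramProj c e‖ ^ 2) ^ 2 := by
  have h := Submodule.norm_sq_eq_add_norm_sq_starProjection (gramProj c e) (ℝ ∙ e)
  rw [Submodule.starProjection_unit_singleton ℝ he, inner_gramProj_self hc, norm_smul, he, mul_one,
    Real.norm_of_nonneg (sq_nonneg _)] at h
  linarith

variable [FiniteDimensional ℝ F] [MeasurableSpace F] [BorelSpace F]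

theorem isRotationInvariantOn_stdGaussian (U : Submodule ℝ F) :
    IsRotationInvariantOn U (stdGaussian F) := fun f _ => stdGaussian_map f

theorem isRotationInvariantOn_map_gramProj {p : ℕ} (e : F) :
    IsRotationInvariantOn (ℝ ∙ e)ᗮ
      ((Measure.pi fun _ : Fin p => stdGaussian F).map fun c => gramProj c e) := by
  intro f hf
  have hfe : f e = e :=
    hf e ((ℝ ∙ e).le_orthogonal_orthogonal (Submodule.mem_span_singleton_self e))
  have hpi := measurePreserving_pi_isometry (ι := Fin p) f
  have hm := measurable_gramProj_left (ι := Fin p) e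
  conv_rhs => rw [← hpi.map_eq, Measure.map_map hm hpi.measurable]
  rw [Measure.map_map f.continuous.measurable hm]
  congr 1
  ext c
  rw [Function.comp_apply, Function.comp_apply, ← gramProj_map, hfe]

end GramProjLaw

section LargeCoords

variable {ι : Type*} [Fintype ι]

open Classical in
/-- The coordinates of `v` whose square is at least `1/1600` of the average. -/
noncomputable def largeCoords (v : EuclideanSpace ℝ ι) : Finset ι :=
  {j | ‖v‖ ^ 2 / (1600 * Fintype.card ι) ≤ v j ^ 2}

theorem mem_largeCoords {v : EuclideanSpace ℝ ι} {j : ι} :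
    j ∈ largeCoords v ↔ ‖v‖ ^ 2 / (1600 * Fintype.card ι) ≤ v j ^ 2 := by
  rw [largeCoords, Finset.mem_filter_univ]

theorem measurable_card_largeCoords :
    Measurable fun v : EuclideanSpace ℝ ι => ((largeCoords v).card : ℝ) := by
  simp only [largeCoords, Finset.card_filter, Nat.cast_sum, Nat.cast_ite, Nat.cast_one,
    Nat.cast_zero]
  exact Finset.measurable_sum _ fun j _ => Measurable.ite
    (measurableSet_le (by fun_prop) (by fun_prop)) measurable_const measurable_const

theorem largeCoords_smul {r : ℝ} (hr : r ≠ 0) (v : EuclideanSpace ℝ ι) :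
    largeCoords (r • v) = largeCoords v := by
  ext j
  rw [mem_largeCoords, mem_largeCoords, norm_smul, mul_pow, Real.norm_eq_abs, sq_abs,
    PiLp.smul_apply, smul_eq_mul, mul_pow, mul_div_assoc, mul_le_mul_iff_right₀ (by positivity)]

theorem stdGaussian_ge_le_exp_sub {f : ℝ → ℝ} (hf : Measurable f) {K : ℝ}
    (hK : ∫⁻ t, ENNReal.ofReal (Real.exp (f t)) ∂gaussianReal 0 1 ≤ ENNReal.ofReal (Real.exp K))
    (t : ℝ) :
    stdGaussian (EuclideanSpace ℝ ι) {g | t ≤ ∑ j, f (g j)} ≤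
      ENNReal.ofReal (Real.exp (Fintype.card ι * K - t)) := by
  have hm : MeasurableSet {g : EuclideanSpace ℝ ι | t ≤ ∑ j, f (g j)} :=
    measurableSet_le measurable_const (by fun_prop)
  rw [← map_pi_eq_stdGaussian, Measure.map_apply (by fun_prop) hm]
  refine (pi_measure_ge_le_exp_sub (fun _ : ι => gaussianReal 0 1) (fun _ => hf) (fun _ => hK)
    t).trans_eq ?_
  rw [Finset.sum_const, Finset.card_univ, nsmul_eq_mul]

variable [DecidableEq ι]

/-- The hyperplane of the vectors whose `i`-th coordinate vanishes. -/
noncomputable abbrev coordHyperplane (i : ι) : Submodule ℝ (EuclideanSpace ℝ ι) :=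
  (ℝ ∙ EuclideanSpace.single i (1 : ℝ))ᗮ

theorem starProjection_coordHyperplane_apply (i j : ι) (v : EuclideanSpace ℝ ι) :
    (coordHyperplane i).starProjection v j = if j = i then 0 else v j := by
  rw [Submodule.starProjection_orthogonal_val, Submodule.starProjection_unit_singleton ℝ (by simp)]
  by_cases h : j = i <;> simp [h, EuclideanSpace.inner_single_left]

theorem card_le_card_largeCoords_add {g : EuclideanSpace ℝ ι}
    (hg : ‖g‖ ^ 2 ≤ 4 * Fintype.card ι) (i : ι) :
    (Fintype.card ι : ℝ) ≤ (largeCoords ((coordHyperplane i).starProjection g)).card +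
      ∑ j, {t : ℝ | |t| < 1 / 20}.indicator 1 (g j) + 1 := by
  classical
  set v := (coordHyperplane i).starProjection g
  have hv : ‖v‖ ^ 2 ≤ 4 * Fintype.card ι :=
    (pow_le_pow_left₀ (norm_nonneg _) (Submodule.norm_starProjection_apply_le _ g) 2).trans hg
  have hcoord : ∀ j, (1 : ℝ) ≤ (if j ∈ largeCoords v then 1 else 0) +
      {t : ℝ | |t| < 1 / 20}.indicator 1 (g j) + if j = i then 1 else 0 := fun j => by
    have hind : 0 ≤ {t : ℝ | |t| < 1 / 20}.indicator (1 : ℝ → ℝ) (g j) :=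
      Set.indicator_nonneg (fun _ _ => zero_le_one) _
    by_cases hji : j = i
    · rw [if_pos hji]
      split_ifs <;> linarith
    by_cases hsmall : |g j| < 1 / 20
    · rw [Set.indicator_of_mem (by exact hsmall), Pi.one_apply]
      split_ifs <;> linarith
    · have hcard : (0 : ℝ) < Fintype.card ι := by exact_mod_cast Fintype.card_pos_iff.mpr ⟨i⟩
      have hmem : j ∈ largeCoords v := by
        rw [mem_largeCoords, starProjection_coordHyperplane_apply, if_neg hji,
          div_le_iff₀ (by positivity), ← sq_abs (g j)]
        nlinarith [pow_le_pow_left₀ (by norm_num) (not_lt.mp hsmall) 2]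
      rw [if_pos hmem, if_neg hji]
      linarith
  calc (Fintype.card ι : ℝ) = ∑ _j : ι, 1 := by simp
    _ ≤ _ := Finset.sum_le_sum fun j _ => hcoord j
    _ = _ := by simp [Finset.sum_add_distrib]

theorem stdGaussian_card_largeCoords_lt_le (hι : 20 ≤ Fintype.card ι) (i : ι) :
    stdGaussian (EuclideanSpace ℝ ι)
      {g | ((largeCoords ((coordHyperplane i).starProjection g)).card : ℝ) <
        3 / 4 * Fintype.card ι} ≤ ENNReal.ofReal (2 * Real.exp (-(Fintype.card ι / 10))) := by
  have hι' : (20 : ℝ) ≤ Fintype.card ι := by exact_mod_cast hι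
  have hnorm := stdGaussian_ge_le_exp_sub (ι := ι) (f := fun t => 1 / 4 * t ^ 2) (by fun_prop)
    (lintegral_exp_mul_sq_gaussianReal_le le_rfl) (Fintype.card ι)
  have hsmall := stdGaussian_ge_le_exp_sub (ι := ι)
    (measurable_one.indicator (measurableSet_lt (by fun_prop) measurable_const))
    (lintegral_exp_indicator_gaussianReal_le (c := 1 / 20) (by norm_num)) (Fintype.card ι / 5)
  refine (measure_mono fun g hg => ?_).trans ((measure_union_le _ _).trans
    ((add_le_add hnorm hsmall).trans ?_))
  · rw [Set.mem_ofPred_eq] at hg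
    by_contra hcon
    simp only [Set.mem_union, Set.mem_ofPred_eq, not_or, not_le, ← Finset.mul_sum,
      ← EuclideanSpace.real_norm_sq_eq] at hcon
    linarith [card_le_card_largeCoords_add (g := g) (by linarith [hcon.1]) i, hcon.2]
  · rw [← ENNReal.ofReal_add (Real.exp_pos _).le (Real.exp_pos _).le, two_mul (Real.exp _)]
    gcongr <;> linarith

theorem pi_stdGaussian_card_largeCoords_lt_le (hι : 20 ≤ Fintype.card ι) {p : ℕ} (i : ι) :
    (Measure.pi fun _ : Fin p => stdGaussian (EuclideanSpace ℝ ι))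
      {c | (coordHyperplane i).starProjection (gramProj c (EuclideanSpace.single i 1)) ≠ 0 ∧
        ((largeCoords ((coordHyperplane i).starProjection
          (gramProj c (EuclideanSpace.single i 1)))).card : ℝ) < 3 / 4 * Fintype.card ι} ≤
      ENNReal.ofReal (2 * Real.exp (-(Fintype.card ι / 10))) := by
  set U := coordHyperplane i
  set μ := Measure.pi fun _ : Fin p => stdGaussian (EuclideanSpace ℝ ι)
  set B : Set (EuclideanSpace ℝ ι) := {v | ((largeCoords v).card : ℝ) < 3 / 4 * Fintype.card ι}
  have hm := measurable_gramProj_left (ι := Fin p) (EuclideanSpace.single i (1 : ℝ))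
  have hB : MeasurableSet B := measurableSet_lt measurable_card_largeCoords measurable_const
  have hcone : ∀ r : ℝ, 0 < r → ∀ z, r • z ∈ B ↔ z ∈ B := fun r hr z => by
    rw [Set.mem_ofPred_eq, Set.mem_ofPred_eq, largeCoords_smul hr.ne']
  have hne : ∀ᵐ g ∂stdGaussian (EuclideanSpace ℝ ι), U.starProjection g ≠ 0 := by
    refine measure_mono_null (fun g hg => ?_)
      (stdGaussian_submodule_eq_zero (U := ℝ ∙ EuclideanSpace.single i (1 : ℝ)) fun htop => ?_)
    · rw [SetLike.mem_coe, ← Submodule.orthogonal_orthogonal (ℝ ∙ _)]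
      exact U.starProjection_apply_eq_zero_iff.mp (not_not.mp hg)
    · have hfin := finrank_span_singleton (K := ℝ) (v := EuclideanSpace.single i (1 : ℝ)) (by simp)
      rw [htop, finrank_top, finrank_euclideanSpace] at hfin
      omega
  have hprob : IsProbabilityMeasure (μ.map fun c => gramProj c (EuclideanSpace.single i 1)) :=
    Measure.isProbabilityMeasure_map hm.aemeasurable
  have h := (isRotationInvariantOn_map_gramProj (p := p)
    (EuclideanSpace.single i (1 : ℝ))).measure_starProjection_mem_le
    (isRotationInvariantOn_stdGaussian U) hne hB hcone
  rw [Measure.map_apply hm] at h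
  · exact h.trans (stdGaussian_card_largeCoords_lt_le hι i)
  · exact (measurableSet_eq_fun (by fun_prop) measurable_const).compl.inter
      (measurableSet_preimage (by fun_prop) hB)

end LargeCoords

section HatMatrix

variable {n p : ℕ} {c : Fin p → EuclideanSpace ℝ (Fin n)}

theorem scatter_rows_one (c : Fin p → EuclideanSpace ℝ (Fin n)) :
    scatter (rows c) 1 = Matrix.gram ℝ c := by
  ext a b
  simp [scatter, outer, rows, Matrix.sum_apply, Matrix.vecMulVec_apply, Matrix.gram_apply,
    PiLp.inner_apply, mul_comm]

theorem cross_rows_one (c : Fin p → EuclideanSpace ℝ (Fin n)) (i j : Fin n) :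
    cross (rows c) 1 i j = gramProj c (EuclideanSpace.single i 1) j := by
  have hrow : (rows c i).ofLp = fun a => inner ℝ (c a) (EuclideanSpace.single i (1 : ℝ)) := by
    ext a
    rw [EuclideanSpace.inner_single_right]
    simp [rows]
  rw [cross, scatter_rows_one, hrow]
  simp [gramProj, rows, dotProduct, mul_comm]

theorem lev_rows_one (hc : LinearIndependent ℝ c) (i : Fin n) :
    lev (rows c) 1 i = ‖gramProj c (EuclideanSpace.single i 1)‖ ^ 2 := by
  rw [← cross_self, cross_rows_one, ← inner_gramProj_self hc, EuclideanSpace.inner_single_left]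
  simp

theorem spread_rows (hc : LinearIndependent ℝ c) {κ : ℝ}
    (hlev : ∀ i, κ ≤ lev (rows c) 1 i - lev (rows c) 1 i ^ 2)
    (hlarge : ∀ i, 3 / 4 * (n : ℝ) ≤ (largeCoords ((coordHyperplane i).starProjection
      (gramProj c (EuclideanSpace.single i 1)))).card) : Spread (rows c) (κ / 1600) := by
  refine fun i => (hlarge i).trans (Nat.cast_le.mpr (Finset.card_le_card fun j hj => ?_))
  rw [mem_largeCoords, norm_sq_starProjection_gramProj hc (by simp), ← lev_rows_one hc,
    starProjection_coordHyperplane_apply, Fintype.card_fin, ← cross_rows_one] at hj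
  rw [Finset.mem_filter_univ, div_div]
  refine (div_le_div_of_nonneg_right (hlev i) (by positivity)).trans (hj.trans ?_)
  split_ifs
  · simpa using sq_nonneg (cross (rows c) 1 i j)
  · exact le_rfl

end HatMatrix

section RegularRows

variable {n p : ℕ} {c : Fin p → EuclideanSpace ℝ (Fin n)} {y ε : ℝ}

theorem isRegular_rows (hc : LinearIndependent ℝ c) (hy₀ : 0 < y) (hy₁ : y < 1)
    (hε₀ : ε ≤ y / 2) (hε₁ : ε ≤ (1 - y) / 2) (hlev : ∀ i, |lev (rows c) 1 i - y| ≤ ε)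
    (hlarge : ∀ i,
      (coordHyperplane i).starProjection (gramProj c (EuclideanSpace.single i 1)) ≠ 0 →
      3 / 4 * (n : ℝ) ≤ (largeCoords ((coordHyperplane i).starProjection
        (gramProj c (EuclideanSpace.single i 1)))).card)
    (hdesign : ‖design (rows c)‖ ^ 2 ≤ n * 256) :
    IsRegular (rows c) y ε (y * (1 - y) / 4 / 1600) 256 := by
  have hκ : 0 < y * (1 - y) / 4 := by nlinarith
  have hlev_sub_sq : ∀ i, y * (1 - y) / 4 ≤ lev (rows c) 1 i - lev (rows c) 1 i ^ 2 := fun i => by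
    have h := abs_le.mp (hlev i)
    nlinarith
  refine ⟨?_, hlev, spread_rows hc hlev_sub_sq fun i => hlarge i fun hzero => ?_, hdesign⟩
  · rw [scatter_rows_one]
    exact Matrix.posDef_gram_iff_linearIndependent.mpr hc
  · have hnorm := norm_sq_starProjection_gramProj hc
      (e := EuclideanSpace.single i (1 : ℝ)) (by simp)
    rw [hzero, norm_zero, ← lev_rows_one hc] at hnorm
    linarith [hlev_sub_sq i]

theorem measure_exists_le_card_mul {ι α : Type*} [Fintype ι] [MeasurableSpace α] {μ : Measure α}
    {q : ι → α → Prop} {r : ℝ} (hq : ∀ i, μ {x | q i x} ≤ ENNReal.ofReal r) :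
    μ {x | ∃ i, q i x} ≤ ENNReal.ofReal (Fintype.card ι * r) := by
  rw [Set.ofPred_exists]
  refine (measure_iUnion_fintype_le _ _).trans ((Finset.sum_le_sum fun i _ => hq i).trans_eq ?_)
  simp [ENNReal.ofReal_mul]

theorem measure_exists_abs_norm_sq_gramProj_sub_ge_le (hpn : p ≤ n) (hε : 0 < ε) (hε₁ : ε ≤ 1) :
    (Measure.pi fun _ : Fin p => stdGaussian (EuclideanSpace ℝ (Fin n)))
      {c | ∃ i, ε ≤ |‖gramProj c (EuclideanSpace.single i 1)‖ ^ 2 - p / n|} ≤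
      ENNReal.ofReal (n * (2 * Real.exp (-(n * ε ^ 2 / 32)))) := by
  have h := measure_exists_le_card_mul fun i : Fin n =>
    pi_stdGaussian_abs_norm_sq_gramProj_sub_ge_le (p := p) (F := EuclideanSpace ℝ (Fin n))
      (e := EuclideanSpace.single i 1) (by simpa) hε hε₁ (by simp)
  simpa only [Fintype.card_fin, finrank_euclideanSpace_fin] using h

theorem measure_exists_card_largeCoords_lt_le (hn : 20 ≤ n) :
    (Measure.pi fun _ : Fin p => stdGaussian (EuclideanSpace ℝ (Fin n)))
      {c | ∃ i, (coordHyperplane i).starProjection (gramProj c (EuclideanSpace.single i 1)) ≠ 0 ∧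
        ((largeCoords ((coordHyperplane i).starProjection
          (gramProj c (EuclideanSpace.single i 1)))).card : ℝ) < 3 / 4 * n} ≤
      ENNReal.ofReal (n * (2 * Real.exp (-(n / 10)))) := by
  have h := measure_exists_le_card_mul fun i : Fin n =>
    pi_stdGaussian_card_largeCoords_lt_le (by simpa) (p := p) i
  simpa only [Fintype.card_fin] using h

theorem measure_norm_design_rows_sq_ge_le (hpn : p ≤ n) :
    (Measure.pi fun _ : Fin p => stdGaussian (EuclideanSpace ℝ (Fin n)))
      {c | n * 256 ≤ ‖design (rows c)‖ ^ 2} ≤ ENNReal.ofReal (Real.exp (-n)) := by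
  have h := measure_norm_design_sq_ge_le (ι := Fin n) (F := EuclideanSpace ℝ (Fin p)) (by simpa)
  rw [Fintype.card_fin] at h
  exact (measurePreserving_rows.measure_preimage_le _).trans h

theorem measure_not_isRegular_rows_le (hn : 20 ≤ n) (hε : 0 < ε) (hε₀ : ε ≤ y / 2)
    (hε₁ : ε ≤ (1 - y) / 2) (hp : |(p : ℝ) / n - y| < ε / 2) :
    (Measure.pi fun _ : Fin p => stdGaussian (EuclideanSpace ℝ (Fin n)))
      {c | ¬IsRegular (rows c) y ε (y * (1 - y) / 4 / 1600) 256} ≤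
      ENNReal.ofReal (5 * n * Real.exp (-(n * (ε / 2) ^ 2 / 32))) := by
  have hn' : (20 : ℝ) ≤ n := by exact_mod_cast hn
  have hpn : p ≤ n := by
    have h : (p : ℝ) / n ≤ 1 := by linarith [(abs_lt.mp hp).2]
    exact_mod_cast (div_le_one (by linarith)).mp h
  have hlin := ae_linearIndependent_stdGaussian (F := EuclideanSpace ℝ (Fin n)) (p := p) (by simpa)
  refine (measure_mono_ae ?_).trans ((measure_union_le _ _).trans ((add_le_add
    (measure_exists_abs_norm_sq_gramProj_sub_ge_le hpn (half_pos hε) (by linarith))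
    ((measure_union_le _ _).trans (add_le_add (measure_exists_card_largeCoords_lt_le hn)
      (measure_norm_design_rows_sq_ge_le hpn)))).trans ?_))
  · refine ae_le_set.mpr (measure_mono_null (fun c ⟨hbad, hcon⟩ => ?_) hlin)
    refine fun hc => hbad ?_
    simp only [Set.mem_union, Set.mem_ofPred_eq, not_or, not_exists, not_and, not_lt,
      not_le] at hcon
    obtain ⟨hlev, hlarge, hdesign⟩ := hcon
    refine isRegular_rows hc (by linarith) (by linarith) hε₀ hε₁ (fun i => ?_) hlarge hdesign.le
    rw [lev_rows_one hc]
    linarith [abs_sub_le (‖gramProj c (EuclideanSpace.single i 1)‖ ^ 2) (p / n) y, hlev i]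
  · set q := Real.exp (-(n * (ε / 2) ^ 2 / 32))
    have hε2 : ε ^ 2 ≤ 1 := pow_le_one₀ hε.le (by linarith)
    have hexp₁ : Real.exp (-(n / 10)) ≤ q := Real.exp_le_exp.mpr (by nlinarith)
    have hexp₂ : Real.exp (-n) ≤ q := Real.exp_le_exp.mpr (by nlinarith)
    rw [← ENNReal.ofReal_add (by positivity) (by positivity),
      ← ENNReal.ofReal_add (by positivity) (by positivity)]
    refine ENNReal.ofReal_le_ofReal ?_
    nlinarith [Real.exp_pos (-(n * (ε / 2) ^ 2 / 32))]

end RegularRows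

section Whitening

variable {n p : ℕ} {Ω : Type*} [MeasurableSpace Ω] {P : Measure Ω}
  {X : Fin n → Ω → EuclideanSpace ℝ (Fin p)} {T : Matrix (Fin p) (Fin p) ℝ}

theorem exists_hasLaw_rows_eq (hT : T.PosDef) (hX : ∀ i, HasLaw (X i) (multivariateGaussian 0 T) P)
    (hind : iIndepFun X P) :
    ∃ Y : Ω → Fin p → EuclideanSpace ℝ (Fin n),
      HasLaw Y (Measure.pi fun _ => stdGaussian (EuclideanSpace ℝ (Fin n))) P ∧
      ∀ ω i, X i ω = Matrix.toEuclideanCLM (𝕜 := ℝ) (CFC.sqrt T) (rows (Y ω) i) := by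
  let e := ContinuousLinearEquiv.unitsEquiv ℝ (EuclideanSpace ℝ (Fin p))
    ((isUnit_sqrt hT).map (Matrix.toEuclideanCLM (𝕜 := ℝ))).unit
  have he : ∀ z, e z = Matrix.toEuclideanCLM (𝕜 := ℝ) (CFC.sqrt T) z := fun z => rfl
  have hsymm : HasLaw e.symm (stdGaussian (EuclideanSpace ℝ (Fin p)))
      (multivariateGaussian 0 T) := by
    refine ⟨by fun_prop, ?_⟩
    simp_rw [multivariateGaussian, zero_add, ← he]
    rw [Measure.map_map (by fun_prop) (by fun_prop), e.symm_comp_self, Measure.map_id]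
  have hlaw := iIndepFun.hasLaw_pi (fun i => hsymm.comp (hX i))
    (hind.comp (fun _ => e.symm) fun _ => by fun_prop)
  exact ⟨_, measurePreserving_rows.comp_hasLaw hlaw, fun ω i => (e.apply_symm_apply _).symm⟩

end Whitening

theorem AdmissibleWeight.exists_measure_not_goodSample_le {u : ℝ → ℝ} {y : ℝ}
    (hu : AdmissibleWeight u) (hy : y ∈ psi u '' Set.Ici 0) (hy₀ : 0 < y) (hy₁ : y < 1) :
    ∃ L η : ℝ, 0 < L ∧ 0 < η ∧ η ≤ 1 ∧ ∀ ε, 0 < ε → ε < η → ∃ δ, 0 < δ ∧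
      ∀ n p : ℕ, 20 ≤ n → |(p : ℝ) / n - y| < δ →
        ∀ T : Matrix (Fin p) (Fin p) ℝ, T.PosDef →
          ∀ (Ω : Type*) [MeasurableSpace Ω] (P : Measure Ω)
            (X : Fin n → Ω → EuclideanSpace ℝ (Fin p)),
            (∀ i, HasLaw (X i) (multivariateGaussian 0 T) P) → iIndepFun X P →
              P {ω | ¬GoodSample u y T (L * ε) fun i => X i ω} ≤
                ENNReal.ofReal (5 * n * Real.exp (-(n * (ε / 2) ^ 2 / 32))) := by
  obtain ⟨L, η, hL, hη, hgood⟩ := hu.exists_goodSample_of_isRegular hy hy₀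
    (c := y * (1 - y) / 4 / 1600) (by nlinarith) (B := 256) (by norm_num)
  have : 0 < 1 - y := by linarith
  refine ⟨L, min η (min (y / 2) ((1 - y) / 2)), hL, by positivity, ?_, fun ε hε hεη => ?_⟩
  · exact (min_le_right _ _).trans ((min_le_left _ _).trans (by linarith))
  simp only [lt_min_iff] at hεη
  obtain ⟨hεη, hεy₀, hεy₁⟩ := hεη
  obtain ⟨δ, hδ, hδ'⟩ := hgood ε hε hεη
  refine ⟨min δ (ε / 2), by positivity, fun n p hn hp T hT Ω _ P X hX hind => ?_⟩
  obtain ⟨hpδ, hpε⟩ := lt_min_iff.mp hp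
  obtain ⟨Y, hY, hXY⟩ := exists_hasLaw_rows_eq hT hX hind
  have hbad : {ω | ¬GoodSample u y T (L * ε) fun i => X i ω} ⊆
      Y ⁻¹' {c | ¬IsRegular (rows c) y ε (y * (1 - y) / 4 / 1600) 256} := fun ω hω hreg => hω <| by
    simpa only [hXY] using goodSample_sqrt hT (hδ' n p _ (by omega) hpδ hreg)
  calc _ ≤ _ := measure_mono hbad
    _ ≤ _ := Measure.le_map_apply hY.aemeasurable _
    _ ≤ _ := hY.map_eq ▸ measure_not_isRegular_rows_le hn hε hεy₀.le hεy₁.le hpε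

theorem mainTheorem7_general (y : ℝ) (hy₀ : 0 < y) (hy₁ : y < 1) (u : ℝ → ℝ)
    (hu : AdmissibleWeight u) (hy : y ∈ psi u '' Set.Ici 0) :
    ∃ C c c' : ℝ, 0 < C ∧ 0 < c ∧ 0 < c' ∧
      ∀ ε : ℝ, 0 < ε → ε < c' →
        ∃ δ : ℝ, 0 < δ ∧
          ∀ n p : ℕ, 0 < n → |(p : ℝ) / n - y| < δ →
            ∀ T : Matrix (Fin p) (Fin p) ℝ, T.PosDef →
              ∀ (Ω : Type*) [MeasurableSpace Ω] (P : Measure Ω) [IsProbabilityMeasure P]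
                (X : Fin n → Ω → EuclideanSpace ℝ (Fin p)),
                (∀ i, HasLaw (X i) (multivariateGaussian 0 T) P) → iIndepFun X P →
                  P.real {ω | ¬ GoodSample u y T ε (fun i => X i ω)}
                    ≤ C * n * Real.exp (-(c * ε ^ 2 * n)) := by
  obtain ⟨L, η, hL, hη, hη₁, h⟩ := hu.exists_measure_not_goodSample_le hy hy₀ hy₁
  refine ⟨Real.exp 20, 1 / (128 * L ^ 2), L * η, by positivity, by positivity, by positivity,
    fun ε hε hεη => ?_⟩
  obtain ⟨r, rfl⟩ : ∃ r, ε = L * r := ⟨ε / L, by field_simp⟩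
  have hr₀ : 0 < r := pos_of_mul_pos_right hε hL.le
  have hrη : r < η := lt_of_mul_lt_mul_left hεη hL.le
  obtain ⟨δ, hδ, hδ'⟩ := h r hr₀ hrη
  refine ⟨δ, hδ, fun n p hn hp T hT Ω _ P _ X hX hind => ?_⟩
  rw [show 1 / (128 * L ^ 2) * (L * r) ^ 2 * n = n * (r / 2) ^ 2 / 32 by field_simp; norm_num]
  rcases lt_or_ge n 20 with hn20 | hn20
  · have hn₁ : (1 : ℝ) ≤ n := by exact_mod_cast hn
    have hn₂ : (n : ℝ) ≤ 20 := by exact_mod_cast hn20.le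
    rw [mul_right_comm, ← Real.exp_add]
    exact measureReal_le_one.trans
      (one_le_mul_of_one_le_of_one_le (Real.one_le_exp (by nlinarith)) hn₁)
  · have hC : 5 ≤ Real.exp 20 := by linarith [Real.add_one_le_exp (20 : ℝ)]
    exact (ENNReal.toReal_le_of_le_ofReal (by positivity)
      (hδ' n p hn20 hp T hT Ω P X hX hind)).trans (by gcongr)

end Maronna

/-- The probability bound is stated for the complementary event, in outer measure, so that it needs
no measurability of the event. -/
theorem mainTheorem7 (y : ℝ) (hy0 : 0 < y) (hy1 : y < 1) (u : ℝ → ℝ)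
    (hu : Maronna.WeightAssumptions u y) :
    ∃ C c c' : ℝ, 0 < C ∧ 0 < c ∧ 0 < c' ∧
      ∀ ε : ℝ, 0 < ε → ε < c' →
        ∃ δ : ℝ, 0 < δ ∧
          ∀ n p : ℕ, 0 < n → |(p : ℝ) / n - y| < δ →
            ∀ T : Matrix (Fin p) (Fin p) ℝ, T.PosDef →
              ∀ (Ω : Type*) [MeasurableSpace Ω] (P : Measure Ω) [IsProbabilityMeasure P]
                (X : Fin n → Ω → EuclideanSpace ℝ (Fin p)),
                (∀ i, HasLaw (X i) (multivariateGaussian 0 T) P) → iIndepFun X P →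
                  P.real {ω | ¬ Maronna.GoodSample u y T ε (fun i => X i ω)}
                    ≤ C * n * Real.exp (-(c * ε ^ 2 * n)) :=
  Maronna.mainTheorem7_general y hy0 hy1 u hu.admissibleWeight
    ⟨_, (Maronna.psiInv_spec hy0 hu).1, (Maronna.psiInv_spec hy0 hu).2.1⟩
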